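/- **Setting.** Let $d\ge 1$, $R,L>0$, $\alpha\ge 1$, let $K\subseteq\mathbb{R}_+^d\cap B(0,R)$ be compact, and let $q_1,\dots,q_d$ be a $\beta$-barycentric spanner of $K$ ($\beta>0$): the $q_i\in K$ are linearly independent and every $x\in K$ is $\sum_i\beta_iq_i$ with $\beta_i\in[-\beta,\beta]$. Put $M=(q_1,\dots,q_d)$, $Q=MM^\top$, $\varphi(x)=\frac12x^\top Q^{-1}x$, with Bregman divergence $D_\varphi(x,y)=\varphi(x)-\varphi(y)-\nabla\varphi(y)^\top(x-y)$. Let $C$ be a closed convex cone with $\mathbb{R}_+^d\subseteq C\subseteq (M^\top)^{-1}\mathbb{R}_+^d$, with dual cone $C^\circ$, and let $\mathcal O$ be an $\alpha$-approximation oracle on $C$: for $w\in C$ it returns $\mathcal O(w)\in K$ with $w^\top\mathcal O(w)\le\alpha\min_{x\in K}w^\top x$. In each round $t=1,\dots,T$ ($T\ge1$) an adversary chooses a loss vector $f_t\in\mathbb{R}_+^d$, $\|f_t\|\le L$, possibly depending on the outcomes of the earlier rounds; write $f_t(x)=f_t^\top x$. The player plays $z_t$ and observes only $f_t(z_t)$.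 **Procedure $\mathrm{PAD}(y)$** (tolerance $\varepsilon$). Start with $z_1=y$, $W_1=C\cap B(0,1)$, $i=0$. While $i<5d\log\frac{2(\alpha R+\|z_{i+1}\|)}{\varepsilon}$: increase $i$ by one; let $w_i$ be the centroid of $W_i$ ($0$ if $W_i$ has volume $0$); call $v_i=\mathcal O(w_i)$; let $z_{i+1}$ minimize $D_\varphi(z,z_i)$ over $\{z: w_i^\top(z-v_i)\ge0\}$; let $W_{i+1}=W_i\cap\{w:w^\top(v_i-z_{i+1})\ge0\}$. On leaving the loop with $i=k$, return $z_{k+1}$, the points $v_1,\dots,v_k$ and a probability vector $p$ that together with some $c\in C^\circ$ minimizes $\|\sum_ip_iv_i+c-z_{k+1}\|$. It makes $k$ oracle calls. **Algorithm** (parameters $\eta>0$, $\varepsilon>0$, $\gamma\in(0,1)$). Let $y_1=\arg\min\varphi$. In round $t$, obtain $x_t$, $(v_i)$, $p$ from $\mathrm{PAD}(y_t)$, except that for $t\ge2$ with $\tilde f_{t-1}=0$ the output of the previous round is reused without oracle calls. With probability $\gamma$ (explore) draw $i_t\in\{1,\dots,d\}$ uniformly, play $z_t=q_{i_t}$ and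 set $\tilde f_t=\frac d\gamma\,(q_{i_t}^\top f_t)\,Q^{-1}q_{i_t}$; otherwise (exploit) play $z_t=v_i$ with probability $p_i$ and set $\tilde f_t=0$. Define $y_{t+1}$ by $\nabla\varphi(y_{t+1})=\nabla\varphi(x_t)-\eta\tilde f_t$. **Theorem.** (a) For all $\gamma\in(0,1)$, $\varepsilon\in(0,\alpha R]$, $\eta>0$, and every $x^*\in K$, $$\mathbb E\Big[\sum_{t=1}^T\big(f_t(z_t)-\alpha f_t(x^*)\big)\Big]\le\frac{\alpha^2\beta^2d}{2\eta}+\frac{\eta L^2R^2d^2}{2\gamma}T+2\gamma\alpha LRT+\varepsilon LT,$$ and the expected total number of oracle calls in $T$ rounds is at most $$(1+\gamma T)\left(1+5d\log\frac{4\alpha R+2R\sqrt{\alpha^2\beta^2d^2+\frac{\eta^2L^2R^2d^3}{\gamma}T+6\eta\alpha LRdT}}{\varepsilon}\right).$$ (b) If $T>\beta^2d^3$ and $\eta=\frac{\alpha\beta^{4/3}}{LRT^{2/3}}$, $\varepsilon=\frac{\alpha R}{T}$, $\gamma=\frac{\beta^{2/3}d}{T^{1/3}}$ (so that $\gamma<1$),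 then for every $x^*\in K$ $$\mathbb E\Big[\sum_{t=1}^T\big(f_t(z_t)-\alpha f_t(x^*)\big)\Big]\le\alpha LR\big(3d(\beta T)^{2/3}+1\big),$$ and the expected total number of oracle calls is at most $c\,d^2(\beta T)^{2/3}\log T$, where $c$ is an absolute constant. -/

import Mathlib

open MeasureTheory
open scoped ENNReal

noncomputable section

namespace OnlineBandit

/-- `ℝᵈ` with the Euclidean inner product and norm. -/
abbrev Vec (d : ℕ) : Type := EuclideanSpace ℝ (Fin d)

/-- The non-negative orthant `ℝ₊ᵈ`. -/
def orthant (d : ℕ) : Set (Vec d) := {x | ∀ i, 0 ≤ x i}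

/-- A minimizer of `f` over `S` (an arbitrary point if there is none). -/
def argminOn {d : ℕ} (f : Vec d → ℝ) (S : Set (Vec d)) : Vec d :=
  Classical.epsilon fun x => x ∈ S ∧ IsMinOn f S x

/-- The Bregman divergence `D_φ(x, y) = φ(x) - φ(y) - ∇φ(y)ᵀ(x - y)`. -/
def bregman {d : ℕ} (φ : Vec d → ℝ) (x y : Vec d) : ℝ :=
  φ x - φ y - inner ℝ (gradient φ y) (x - y)

/-! ### Barycentric spanners -/

/-- `q₁, …, q_d` is a `β`-barycentric spanner of `K`: the vectors are linearly independent, lie in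
`K`, and every point of `K` is a combination of them with coefficients in `[-β, β]`. -/
structure IsBarycentricSpanner {d : ℕ} (β : ℝ) (q : Fin d → Vec d) (K : Set (Vec d)) : Prop where
  linearIndependent : LinearIndependent ℝ q
  mem : ∀ i, q i ∈ K
  exists_coeff : ∀ x ∈ K, ∃ b : Fin d → ℝ, (∀ i, b i ∈ Set.Icc (-β) β) ∧ x = ∑ i, b i • q i

/-- The matrix `M = (q₁, …, q_d)` with columns `qᵢ`. -/
def spannerMatrix {d : ℕ} (q : Fin d → Vec d) : Matrix (Fin d) (Fin d) ℝ :=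
  Matrix.of fun r c => q c r

/-- `Q = ∑ᵢ qᵢ qᵢᵀ = M Mᵀ`. -/
def gramQ {d : ℕ} (q : Fin d → Vec d) : Matrix (Fin d) (Fin d) ℝ :=
  spannerMatrix q * (spannerMatrix q).transpose

/-- `Q⁻¹ x` as a vector of Euclidean space. -/
def applyQinv {d : ℕ} (q : Fin d → Vec d) (x : Vec d) : Vec d :=
  WithLp.toLp 2 ((gramQ q)⁻¹.mulVec x.ofLp)

/-- The barycentric regularizer `φ(x) = ½ xᵀ Q⁻¹ x`. -/
def barycentricRegularizer {d : ℕ} (q : Fin d → Vec d) (x : Vec d) : ℝ :=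
  (1 / 2) * inner ℝ x (applyQinv q x)

/-- The cone `(Mᵀ)⁻¹ ℝ₊ᵈ`. -/
def spannerCone {d : ℕ} (q : Fin d → Vec d) : Set (Vec d) :=
  (fun u : Vec d => WithLp.toLp 2 (((spannerMatrix q).transpose)⁻¹.mulVec u.ofLp)) '' orthant d

/-! ### The projection-and-decomposition procedure -/

/-- The data with which online mirror descent is instantiated. -/
structure OMDData (d : ℕ) where
  /-- the linear optimization oracle -/
  oracle : Vec d → Vec d
  /-- the (closed convex) cone handed to the projection-and-decomposition procedure -/
  cone : ProperCone ℝ (Vec d)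
  /-- the regularizer `φ` -/
  reg : Vec d → ℝ
  /-- radius of a ball around `0` that contains the played set and the comparison set -/
  radius : ℝ
  /-- the tolerance `ε` -/
  tol : ℝ
  /-- the learning rate `η` -/
  rate : ℝ
  /-- the rule by which one of several optimal weight vectors is picked -/
  pick : (k : ℕ) → Set (Fin k → ℝ) → (Fin k → ℝ)

/-- The centroid `∫_W w dw / vol(W)` (which is `0` if `vol(W) = 0`). -/
def centroid {d : ℕ} (W : Set (Vec d)) : Vec d := ⨍ w in W, w

/-- One pass through the loop, from `(zᵢ, Wᵢ)` to `(zᵢ₊₁, Wᵢ₊₁)`: with `w` the centroid of `Wᵢ` and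
`v` the answer of the oracle to `w` (one oracle call), project `zᵢ` onto the half-space
`{z | wᵀ(z - v) ≥ 0}` in the Bregman divergence and cut `Wᵢ` by `{u | uᵀ(v - zᵢ₊₁) ≥ 0}`. -/
def padStep {d : ℕ} (D : OMDData d) (s : Vec d × Set (Vec d)) : Vec d × Set (Vec d) :=
  let w := centroid s.2
  let v := D.oracle w
  let z := argminOn (fun x => bregman D.reg x s.1) {x | 0 ≤ inner ℝ w (x - v)}
  (z, s.2 ∩ {u | 0 ≤ inner ℝ u (v - z)})

/-- The pair `(z, W)` after `i` passes through the loop started at `(y, cone ∩ B(0, 1))`. -/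
def padState {d : ℕ} (D : OMDData d) (y : Vec d) (i : ℕ) : Vec d × Set (Vec d) :=
  (padStep D)^[i] (y, (D.cone : Set (Vec d)) ∩ Metric.closedBall 0 1)

/-- The oracle's answer in the pass number `i + 1`. -/
def padAtom {d : ℕ} (D : OMDData d) (y : Vec d) (i : ℕ) : Vec d :=
  D.oracle (centroid (padState D y i).2)

/-- The number of passes, i.e. of oracle calls: the loop is left at the first `i` for which
`i < 5 d log (2 (radius + ‖z‖) / ε)` fails, `z` being the current point. It is `⊤` if the loop is
never left. -/
def padCalls {d : ℕ} (D : OMDData d) (y : Vec d) : ℕ∞ :=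
  ⨅ (i : ℕ) (_ : ¬ ((i : ℝ) <
    5 * d * Real.log (2 * (D.radius + ‖(padState D y i).1‖) / D.tol))), (i : ℕ∞)

/-- `‖∑ pᵢ vᵢ + c - x‖`. -/
def decompositionError {d k : ℕ} (v : ℕ → Vec d) (x : Vec d) (p : Fin k → ℝ) (c : Vec d) : ℝ :=
  ‖(∑ i : Fin k, p i • v i) + c - x‖

/-- The weight vectors `p` of the minimizers `(p, c)` of `‖∑ pᵢ vᵢ + c - x‖` over the simplex times
the dual cone. -/
def optimalWeights {d : ℕ} (C : ProperCone ℝ (Vec d)) (k : ℕ) (v : ℕ → Vec d) (x : Vec d) :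
    Set (Fin k → ℝ) :=
  {p | p ∈ stdSimplex ℝ (Fin k) ∧ ∃ c ∈ ProperCone.innerDual (C : Set (Vec d)),
    ∀ p' ∈ stdSimplex ℝ (Fin k), ∀ c' ∈ ProperCone.innerDual (C : Set (Vec d)),
      decompositionError v x p c ≤ decompositionError v x p' c'}

/-- The output of the projection-and-decomposition procedure: the infeasible projection and the
points `v₁, …, v_k` (stored as `atom 0, …, atom (k - 1)`) with their weights; `calls` is the number
of oracle calls that produced it. -/
structure PADOutput (d : ℕ) where
  point : Vec d
  calls : ℕ∞
  size : ℕ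
  atom : ℕ → Vec d
  weight : Fin size → ℝ

/-- The projection-and-decomposition procedure at `y`. -/
def pad {d : ℕ} (D : OMDData d) (y : Vec d) : PADOutput d :=
  let k := (padCalls D y).toNat
  let x := (padState D y k).1
  { point := x
    calls := padCalls D y
    size := k
    atom := padAtom D y
    weight := D.pick k (optimalWeights D.cone k (padAtom D y) x) }

open Classical in
/-- The law of the index `j` drawn with probabilities `p₀, …, p_{k-1}`. -/
def indexLaw {k : ℕ} (p : Fin k → ℝ) : PMF ℕ :=
  if h : p ∈ stdSimplex ℝ (Fin k) then
    (PMF.ofFintype (fun j => ENNReal.ofReal (p j)) (by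
      rw [← ENNReal.ofReal_sum_of_nonneg fun j _ => h.1 j, h.2, ENNReal.ofReal_one])).map
        (fun j => (j : ℕ))
  else PMF.pure 0

/-! ### Online mirror descent -/

/-- The first point `y₁ = argmin φ`. -/
def initialPoint {d : ℕ} (D : OMDData d) : Vec d := argminOn D.reg Set.univ

/-- The next point `y₊`, given by `∇φ(y₊) = ∇φ(x) - η g`. -/
def mirrorStep {d : ℕ} (D : OMDData d) (x g : Vec d) : Vec d :=
  Classical.epsilon fun y => gradient D.reg y = gradient D.reg x - D.rate • g

/-! ### The bandit algorithm -/

/-- The random choices of one round: either EXPLORE together with the index `i` of the spanner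
element played, or EXPLOIT together with the index `j` of the point of the current decomposition
that is played. -/
inductive Outcome (d : ℕ) : Type
  | explore (i : Fin d) : Outcome d
  | exploit (j : ℕ) : Outcome d

/-- The outcomes of the rounds played so far, the most recent one first. -/
abbrev History (d : ℕ) : Type := List (Outcome d)

/-- All sets of histories are measurable (there are countably many histories). -/
instance instMeasurableSpaceHistory (d : ℕ) : MeasurableSpace (List (Outcome d)) := ⊤

/-- An adaptive adversary: the loss vector of a round as a function of the outcomes of the previous
rounds. -/
abbrev Adversary (d : ℕ) : Type := History d → Vec d

/-- The data of the bandit algorithm: those of online mirror descent, the spanner and the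
exploration probability. -/
structure BanditData (d : ℕ) extends OMDData d where
  spanner : Fin d → Vec d
  explorProb : ℝ

/-- The point played in a round with outcome `r` if `out` is the current output of the
projection-and-decomposition procedure. -/
def playedPoint {d : ℕ} (B : BanditData d) (out : PADOutput d) : Outcome d → Vec d
  | .explore i => B.spanner i
  | .exploit j => out.atom j

/-- The estimated loss vector: `(d/γ) (qᵢᵀ f) Q⁻¹ qᵢ` after EXPLORE and `0` after EXPLOIT. -/
def lossEstimate {d : ℕ} (B : BanditData d) (f : Vec d) : Outcome d → Vec d
  | .explore i => ((d : ℝ) / B.explorProb * inner ℝ (B.spanner i) f) • applyQinv B.spanner (B.spanner i)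
  | .exploit _ => 0

open Classical in
/-- The decomposition used in the round that follows the history. It is computed afresh in round
`1` and whenever the previous loss estimate is non-zero; otherwise the previous one is kept. -/
def currentOutput {d : ℕ} (B : BanditData d) (f : Adversary d) : History d → PADOutput d
  | [] => pad B.toOMDData (initialPoint B.toOMDData)
  | r :: h =>
    let prev := currentOutput B f h
    let g := lossEstimate B (f h) r
    if g = 0 then prev else pad B.toOMDData (mirrorStep B.toOMDData prev.point g)

open Classical in
/-- The number of oracle calls made in the round that follows the history. -/
def roundCalls {d : ℕ} (B : BanditData d) (f : Adversary d) : History d → ℕ∞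
  | [] => (currentOutput B f []).calls
  | r :: h => if lossEstimate B (f h) r = 0 then 0 else (currentOutput B f (r :: h)).calls

/-- The law of the outcome of a round: EXPLORE with probability `γ` (a number in `[0, 1]`) and then
a uniform index, otherwise an index drawn according to the weights of the decomposition. -/
def roundLaw {d : ℕ} [NeZero d] (B : BanditData d) (out : PADOutput d) : PMF (Outcome d) :=
  (PMF.ofFintype
    (fun b : Bool => cond b (min (ENNReal.ofReal B.explorProb) 1)
      (1 - min (ENNReal.ofReal B.explorProb) 1)) (by simp)).bind fun b =>
    cond b ((PMF.uniformOfFintype (Fin d)).map Outcome.explore)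
      ((indexLaw out.weight).map Outcome.exploit)

/-- The law of the history of the first `T` rounds. -/
def historyLaw {d : ℕ} [NeZero d] (B : BanditData d) (f : Adversary d) : ℕ → PMF (History d)
  | 0 => PMF.pure []
  | T + 1 => (historyLaw B f T).bind fun h =>
      (roundLaw B (currentOutput B f h)).map fun r => r :: h

/-- `∑ₜ (fₜ(zₜ) - α fₜ(x))` over the rounds of a history, `zₜ` being the point played in round
`t`. -/
def regretAgainst {d : ℕ} (B : BanditData d) (f : Adversary d) (α : ℝ) (x : Vec d) :
    History d → ℝ
  | [] => 0
  | r :: h => regretAgainst B f α x h +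
      (inner ℝ (f h) (playedPoint B (currentOutput B f h) r) - α * inner ℝ (f h) x)

/-- The number of oracle calls made in the rounds of a history. -/
def totalCalls {d : ℕ} (B : BanditData d) (f : Adversary d) : History d → ℕ∞
  | [] => 0
  | _ :: h => totalCalls B f h + roundCalls B f h

/-- The bandit algorithm for the comparison set `α K`, `K ⊆ B(0, R)`: online mirror descent with
the barycentric regularizer of the spanner `q`. -/
def banditAlgorithm {d : ℕ} (oracle : Vec d → Vec d) (C : ProperCone ℝ (Vec d))
    (pick : (k : ℕ) → Set (Fin k → ℝ) → (Fin k → ℝ)) (q : Fin d → Vec d) (α R η ε γ : ℝ) :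
    BanditData d where
  oracle := oracle
  cone := C
  reg := barycentricRegularizer q
  radius := α * R
  tol := ε
  rate := η
  pick := pick
  spanner := q
  explorProb := γ

end OnlineBandit

end

open OnlineBandit

noncomputable section
/-! ### The Prékopa–Leindler inequality -/

/-! In the coordinates `M⁻¹ x` the regularizer is half the squared Euclidean norm, so mirror descent
is gradient descent, a Bregman projection is an orthogonal projection, and `α K` lies in the ball of
squared radius `α² β² d`. Write `D` for the squared distance, in these coordinates, of the current
point from `α x`, where `x ∈ K`.

The projection procedure. The oracle's guarantee says that `α x` belongs to every half-space onto
which the procedure projects, so no pass increases `D`; the iterates stay bounded and the loop ends.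
A projection moves the point along `Q w` with `w ∈ C`. Vectors of `C` have non-negative inner
products with all `qᵢ`, so `⟪h, Q w⟫ ≥ 0` for `h ∈ C`, and `⟪h, zᵢ⟫` never decreases
(`inner_padState_mono`). If on exit a unit-bounded `h ∈ C` satisfied `⟪h, vᵢ - z⟫ ≥ e > ε` for all
`i`, then a copy of `C ∩ B(0, 1)` shrunk towards `h` would have survived all cuts. By Grünbaum's
inequality each cut leaves at most the fraction `1 - 1/e` of the volume (with Euler's number here),
and after `5 d log(…)` cuts too little is left (`not_separated`). Projecting `z` onto the convex
hull of the atoms plus the dual cone turns this into a decomposition with error at most `ε`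
(`exists_decompositionError_le`), whose loss for `f ≥ 0` exceeds that of `z` by at most `ε ‖f‖`.

Grünbaum's inequality comes from the Prékopa–Leindler inequality: the distribution function `F` of a
linear functional on a convex body is log-concave, the mean of `log F` is at least `-1`, and
Jensen's inequality gives `log F(mean) ≥ -1`.

Regret. The vector `qᵢ` has coordinate vector `eᵢ`, so the loss estimate is unbiased: in one round
the expectation of `D` falls by at least `2 η ⟪f, z - α x⟫` up to the second-order term `η² d² L² R²
/ γ`. Hence regret plus `D / (2 η)` grows in expectation by a constant per round
(`expect_regretAgainst_le`).

Oracle calls. The procedure reruns only after an exploration, which happens with probability `γ`,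
and a run costs a concave function of `D`. A tangent line of that function, together with the linear
growth of the expectation of `D`, bounds the expected total (`expect_callsUpper_le`). -/

open Set in
theorem Real.volume_add_volume_le_of_isCompact {A B C : Set ℝ} (hA : IsCompact A) (hB : IsCompact B)
    (hA0 : A.Nonempty) (hB0 : B.Nonempty) (hC : ∀ a ∈ A, ∀ b ∈ B, a + b ∈ C) :
    volume A + volume B ≤ volume C := by
  obtain ⟨a, ha, ha'⟩ := hA.exists_isGreatest hA0
  obtain ⟨b, hb, hb'⟩ := hB.exists_isLeast hB0
  have h1 : volume ((fun x => b + x) '' A) = volume A := by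
    simp
  have h2 : volume ((fun x => a + x) '' B) = volume B := by
    simp
  have hm : MeasurableSet ((fun x => a + x) '' B) :=
    (hB.image (continuous_const.add continuous_id)).measurableSet
  -- The translate of `A` by `min B` and that of `B` by `max A` both lie in `C` and share at most
  -- the point `max A + min B`.
  rw [← h1, ← h2, ← measure_union₀ hm.nullMeasurableSet]
  · refine measure_mono ?_
    rintro x (⟨y, hy, rfl⟩ | ⟨y, hy, rfl⟩)
    · simpa [add_comm] using hC y hy b hb
    · exact hC a ha y hy
  · refine measure_mono_null (t := {a + b}) ?_ (by simp)
    rintro x ⟨⟨y, hy, rfl⟩, ⟨z, hz, hzy⟩⟩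
    have := ha' hy
    have := hb' hz
    simp only [mem_singleton_iff] at *
    linarith

/-- The one-dimensional Brunn–Minkowski inequality. -/
theorem Real.volume_add_volume_le {A B C : Set ℝ} (hA : MeasurableSet A) (hB : MeasurableSet B)
    (hA0 : A.Nonempty) (hB0 : B.Nonempty) (hC : ∀ a ∈ A, ∀ b ∈ B, a + b ∈ C) :
    volume A + volume B ≤ volume C := by
  obtain ⟨a, ha⟩ := hA0
  obtain ⟨b, hb⟩ := hB0
  by_cases hA1 : volume A = 0
  · rw [hA1, zero_add, ← (by simp : volume ((fun x => a + x) '' B) = volume B)]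
    refine measure_mono ?_
    rintro _ ⟨y, hy, rfl⟩
    exact hC a ha y hy
  by_cases hB1 : volume B = 0
  · rw [hB1, add_zero, ← (by simp : volume ((fun x => b + x) '' A) = volume A)]
    refine measure_mono ?_
    rintro _ ⟨y, hy, rfl⟩
    simpa [add_comm] using hC y hy b hb
  refine le_of_forall_lt fun c hc => ?_
  obtain ⟨r, hr, s, hs, hrs⟩ := ENNReal.exists_lt_add_of_lt_add hc hA1 hB1
  obtain ⟨K, hKA, hK, hrK⟩ := hA.exists_lt_isCompact hr
  obtain ⟨K', hKB, hK', hsK⟩ := hB.exists_lt_isCompact hs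
  refine hrs.trans_le ((add_le_add hrK.le hsK.le).trans ?_)
  refine Real.volume_add_volume_le_of_isCompact hK hK' ?_ ?_
    fun x hx y hy => hC x (hKA hx) y (hKB hy)
  · exact nonempty_of_measure_ne_zero (bot_lt_iff_ne_bot.1 (bot_le.trans_lt hrK))
  · exact nonempty_of_measure_ne_zero (bot_lt_iff_ne_bot.1 (bot_le.trans_lt hsK))

open scoped Pointwise in
theorem Real.ofReal_mul_volume_add_le {A B C : Set ℝ} {l : ℝ} (h0 : 0 < l) (h1 : l < 1)
    (hA : MeasurableSet A) (hB : MeasurableSet B) (hA0 : A.Nonempty) (hB0 : B.Nonempty)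
    (hC : ∀ a ∈ A, ∀ b ∈ B, (1 - l) * a + l * b ∈ C) :
    ENNReal.ofReal (1 - l) * volume A + ENNReal.ofReal l * volume B ≤ volume C := by
  have key : ∀ (r : ℝ) (S : Set ℝ), 0 < r → volume (r • S) = ENNReal.ofReal r * volume S := by
    intro r S hr
    rw [Measure.addHaar_smul]
    simp [abs_of_pos hr]
  have h1' : 0 < 1 - l := by linarith
  rw [← key _ _ h0, ← key _ _ h1']
  refine Real.volume_add_volume_le (hA.const_smul₀ _) (hB.const_smul₀ _) hA0.smul_set
    hB0.smul_set ?_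
  rintro _ ⟨a, ha, rfl⟩ _ ⟨b, hb, rfl⟩
  exact hC a ha b hb

theorem ENNReal.geom_mean_le_arith_mean2_weighted {l : ℝ} (h0 : 0 < l) (h1 : l < 1) (a b : ℝ≥0∞) :
    a ^ (1 - l) * b ^ l ≤ ENNReal.ofReal (1 - l) * a + ENNReal.ofReal l * b := by
  have h1' : 0 < 1 - l := by linarith
  by_cases ha : a = ∞
  · have : ENNReal.ofReal (1 - l) * a = ∞ := by
      rw [ha, ENNReal.mul_top (by simpa using h1)]
    rw [this]; simp
  by_cases hb : b = ∞
  · have : ENNReal.ofReal l * b = ∞ := by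
      rw [hb, ENNReal.mul_top (by simpa using h0)]
    rw [this]; simp
  lift a to NNReal using ha
  lift b to NNReal using hb
  rw [← ENNReal.coe_rpow_of_nonneg _ h1'.le, ← ENNReal.coe_rpow_of_nonneg _ h0.le]
  have := NNReal.geom_mean_le_arith_mean2_weighted (1 - l).toNNReal l.toNNReal a b (by
    rw [← Real.toNNReal_add h1'.le h0.le]; simp)
  rw [Real.coe_toNNReal _ h1'.le, Real.coe_toNNReal _ h0.le] at this
  unfold ENNReal.ofReal
  exact_mod_cast this

/-- The Prékopa–Leindler inequality on the line for functions with supremum one, in its arithmetic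
mean form. -/
theorem Real.prekopa_leindler_of_iSup_eq_one {f g h : ℝ → ℝ≥0∞} {l : ℝ} (h0 : 0 < l) (h1 : l < 1)
    (hf : Measurable f) (hg : Measurable g) (hh : Measurable h)
    (hf1 : ⨆ x, f x = 1) (hg1 : ⨆ x, g x = 1)
    (hfgh : ∀ x y, f x ^ (1 - l) * g y ^ l ≤ h ((1 - l) * x + l * y)) :
    ENNReal.ofReal (1 - l) * (∫⁻ x, f x) + ENNReal.ofReal l * (∫⁻ x, g x) ≤ ∫⁻ x, h x := by
  have h1' : 0 < 1 - l := by linarith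
  have layer : ∀ u : ℝ → ℝ≥0∞, Measurable u → (∀ x, u x ≤ 1) →
      ∫⁻ x, u x = ∫⁻ t in Set.Ioi (0 : ℝ), volume {x | ENNReal.ofReal t < u x} := by
    intro u hu hu1
    have := lintegral_eq_lintegral_meas_lt volume (f := fun x => (u x).toReal)
      (Filter.Eventually.of_forall fun x => ENNReal.toReal_nonneg) hu.ennreal_toReal.aemeasurable
    have hfin : ∀ x, u x ≠ ∞ := fun x => ne_top_of_le_ne_top ENNReal.one_ne_top (hu1 x)
    simp only [ENNReal.ofReal_toReal (hfin _)] at this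
    rw [this]
    refine setLIntegral_congr_fun measurableSet_Ioi fun t ht => ?_
    simp only [ENNReal.ofReal_lt_iff_lt_toReal (le_of_lt ht) (hfin _)]
  have hf2 : ∀ x, f x ≤ 1 := fun x => hf1 ▸ le_iSup f x
  have hg2 : ∀ x, g x ≤ 1 := fun x => hg1 ▸ le_iSup g x
  -- Only levels below `1` contribute, so cutting `h` off at `1` is harmless; it makes `h` finite,
  -- as the layer-cake formula requires.
  have hh' : Measurable fun x => min (h x) 1 := hh.min measurable_const
  refine le_trans ?_ (lintegral_mono fun x => min_le_left (h x) 1)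
  rw [layer f hf hf2, layer g hg hg2, layer _ hh' fun x => min_le_right _ _]
  have mf : ∀ u : ℝ → ℝ≥0∞, Measurable fun t : ℝ => volume {x | ENNReal.ofReal t < u x} :=
    fun u => Antitone.measurable fun s t hst => measure_mono fun x hx =>
      (ENNReal.ofReal_le_ofReal hst).trans_lt hx
  rw [← lintegral_const_mul _ (mf f), ← lintegral_const_mul _ (mf g),
    ← lintegral_add_left ((mf f).const_mul _)]
  refine setLIntegral_mono (mf _) fun t ht => ?_
  by_cases ht1 : 1 ≤ ENNReal.ofReal t
  · have : ∀ u : ℝ → ℝ≥0∞, (∀ x, u x ≤ 1) → {x | ENNReal.ofReal t < u x} = ∅ := by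
      intro u hu
      ext x
      simpa using (hu x).trans ht1
    simp [this f hf2, this g hg2]
  · push Not at ht1
    -- One-dimensional Brunn–Minkowski for the superlevel sets. Both are non-empty below level `1`
    -- because both suprema equal `1`; this is the reason for the normalization.
    refine Real.ofReal_mul_volume_add_le h0 h1 (measurableSet_lt measurable_const hf)
      (measurableSet_lt measurable_const hg) ?_ ?_ ?_
    · obtain ⟨x, hx⟩ := lt_iSup_iff.1 (hf1.symm ▸ ht1); exact ⟨x, hx⟩
    · obtain ⟨x, hx⟩ := lt_iSup_iff.1 (hg1.symm ▸ ht1); exact ⟨x, hx⟩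
    · intro x hx y hy
      refine lt_min (lt_of_lt_of_le ?_ (hfgh x y)) ht1
      have ht0 : ENNReal.ofReal t ≠ 0 := by simpa using ht
      calc ENNReal.ofReal t = ENNReal.ofReal t ^ (1 - l) * ENNReal.ofReal t ^ l := by
            rw [← ENNReal.rpow_add _ _ ht0 ENNReal.ofReal_ne_top]; simp
        _ < f x ^ (1 - l) * g y ^ l :=
            ENNReal.mul_lt_mul (ENNReal.rpow_lt_rpow hx h1') (ENNReal.rpow_lt_rpow hy h0)

/-- Dividing `f`, `g`, `h` by `a = sup f`, `b = sup g` and `a ^ (1 - l) * b ^ l` preserves the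
hypothesis and reduces to suprema equal to one; the weighted mean inequality then gives the product
form, which is homogeneous. -/
theorem Real.prekopa_leindler_of_bounded {f g h : ℝ → ℝ≥0∞} {l : ℝ} (h0 : 0 < l) (h1 : l < 1)
    (hf : Measurable f) (hg : Measurable g) (hh : Measurable h)
    (hf1 : ⨆ x, f x ≠ ∞) (hg1 : ⨆ x, g x ≠ ∞)
    (hfgh : ∀ x y, f x ^ (1 - l) * g y ^ l ≤ h ((1 - l) * x + l * y)) :
    (∫⁻ x, f x) ^ (1 - l) * (∫⁻ x, g x) ^ l ≤ ∫⁻ x, h x := by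
  have h1' : 0 < 1 - l := by linarith
  set a := ⨆ x, f x with ha
  set b := ⨆ x, g x with hb
  by_cases ha0 : a = 0
  · have : ∀ x, f x = 0 := fun x => le_antisymm (ha0 ▸ le_iSup f x) zero_le
    simp [this, ENNReal.zero_rpow_of_pos h1']
  by_cases hb0 : b = 0
  · have : ∀ x, g x = 0 := fun x => le_antisymm (hb0 ▸ le_iSup g x) zero_le
    simp [this, ENNReal.zero_rpow_of_pos h0]
  set c := a ^ (1 - l) * b ^ l with hc
  have hc0 : c ≠ 0 := mul_ne_zero
    (by simp [ENNReal.rpow_eq_zero_iff, ha0, hf1]) (by simp [ENNReal.rpow_eq_zero_iff, hb0, hg1])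
  have hct : c ≠ ∞ := ENNReal.mul_ne_top (ENNReal.rpow_ne_top_of_nonneg h1'.le hf1)
    (ENNReal.rpow_ne_top_of_nonneg h0.le hg1)
  have cinv : (a⁻¹) ^ (1 - l) * (b⁻¹) ^ l = c⁻¹ := by
    rw [ENNReal.inv_rpow, ENNReal.inv_rpow, hc, ENNReal.mul_inv]
    · exact Or.inr (ENNReal.rpow_ne_top_of_nonneg h0.le hg1)
    · exact Or.inl (ENNReal.rpow_ne_top_of_nonneg h1'.le hf1)
  have key := Real.prekopa_leindler_of_iSup_eq_one (f := fun x => a⁻¹ * f x)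
    (g := fun x => b⁻¹ * g x) (h := fun x => c⁻¹ * h x) h0 h1 (hf.const_mul _) (hg.const_mul _)
    (hh.const_mul _) (by rw [← ENNReal.mul_iSup, ← ha, ENNReal.inv_mul_cancel ha0 hf1])
    (by rw [← ENNReal.mul_iSup, ← hb, ENNReal.inv_mul_cancel hb0 hg1]) (by
      intro x y
      rw [ENNReal.mul_rpow_of_nonneg _ _ h1'.le, ENNReal.mul_rpow_of_nonneg _ _ h0.le,
        mul_mul_mul_comm, cinv]
      gcongr
      exact hfgh x y)
  rw [lintegral_const_mul _ hf, lintegral_const_mul _ hg, lintegral_const_mul _ hh] at key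
  have := (ENNReal.geom_mean_le_arith_mean2_weighted h0 h1 _ _).trans key
  rw [ENNReal.mul_rpow_of_nonneg _ _ h1'.le, ENNReal.mul_rpow_of_nonneg _ _ h0.le,
        mul_mul_mul_comm, cinv] at this
  exact (ENNReal.mul_le_mul_iff_right (ENNReal.inv_ne_zero.2 hct) (ENNReal.inv_ne_top.2 hc0)).1 this

/-- The Prékopa–Leindler inequality on the line. -/
theorem Real.prekopa_leindler {f g h : ℝ → ℝ≥0∞} {l : ℝ} (h0 : 0 < l) (h1 : l < 1)
    (hf : Measurable f) (hg : Measurable g) (hh : Measurable h)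
    (hfgh : ∀ x y, f x ^ (1 - l) * g y ^ l ≤ h ((1 - l) * x + l * y)) :
    (∫⁻ x, f x) ^ (1 - l) * (∫⁻ x, g x) ^ l ≤ ∫⁻ x, h x := by
  have h1' : 0 < 1 - l := by linarith
  -- Vanishing integrals are set aside because multiplication in `ℝ≥0∞` is discontinuous at `(0,
  -- ∞)`, which would spoil the passage to the limit in the truncations `min u n`.
  by_cases hf0 : ∫⁻ x, f x = 0
  · simp [hf0, ENNReal.zero_rpow_of_pos h1']
  by_cases hg0 : ∫⁻ x, g x = 0
  · simp [hg0, ENNReal.zero_rpow_of_pos h0]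
  have lim : ∀ u : ℝ → ℝ≥0∞, Measurable u →
      Filter.Tendsto (fun n : ℕ => ∫⁻ x, min (u x) n) Filter.atTop (nhds (∫⁻ x, u x)) := by
    intro u hu
    refine lintegral_tendsto_of_tendsto_of_monotone
      (fun n => (hu.min measurable_const).aemeasurable)
      (Filter.Eventually.of_forall fun x m n hmn => min_le_min le_rfl (by exact_mod_cast hmn))
      (Filter.Eventually.of_forall fun x => ?_)
    have := (tendsto_const_nhds (x := u x)).min ENNReal.tendsto_nat_nhds_top
    simpa using this
  have hT := ENNReal.Tendsto.mul
    ((ENNReal.continuous_rpow_const (y := 1 - l)).continuousAt.tendsto.comp (lim f hf))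
    (Or.inl (by simp [ENNReal.rpow_eq_zero_iff, hf0, h1'.not_gt]))
    ((ENNReal.continuous_rpow_const (y := l)).continuousAt.tendsto.comp (lim g hg))
    (Or.inl (by simp [ENNReal.rpow_eq_zero_iff, hg0, h0.not_gt]))
  refine le_of_tendsto' hT fun n => ?_
  have bd : ∀ u : ℝ → ℝ≥0∞, ⨆ x, min (u x) (n : ℝ≥0∞) ≠ ∞ := fun u =>
    ne_top_of_le_ne_top (ENNReal.natCast_ne_top n) (iSup_le fun x => min_le_right _ _)
  refine Real.prekopa_leindler_of_bounded h0 h1 (hf.min measurable_const)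
    (hg.min measurable_const) hh (bd f) (bd g) fun x y => le_trans ?_ (hfgh x y)
  gcongr
  · exact min_le_left _ _
  · exact min_le_left _ _

/-- The Prékopa–Leindler inequality. -/
theorem prekopa_leindler {n : ℕ} {f g h : (Fin n → ℝ) → ℝ≥0∞} {l : ℝ} (h0 : 0 < l) (h1 : l < 1)
    (hf : Measurable f) (hg : Measurable g) (hh : Measurable h)
    (hfgh : ∀ x y, f x ^ (1 - l) * g y ^ l ≤ h ((1 - l) • x + l • y)) :
    (∫⁻ x, f x) ^ (1 - l) * (∫⁻ x, g x) ^ l ≤ ∫⁻ x, h x := by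
  induction n with
  | zero =>
    have : ∀ u : (Fin 0 → ℝ) → ℝ≥0∞, ∫⁻ x, u x = u 0 := by
      intro u
      rw [volume_pi, Measure.pi_of_empty _ 0, lintegral_dirac]
    rw [this, this, this]
    convert hfgh 0 0
  | succ n ih =>
    let e := MeasurableEquiv.piFinSuccAbove (fun _ : Fin (n + 1) => ℝ) 0
    have he : MeasurePreserving e.symm := (volume_preserving_piFinSuccAbove
      (fun _ : Fin (n + 1) => ℝ) 0).symm _
    have fub : ∀ u : (Fin (n + 1) → ℝ) → ℝ≥0∞, Measurable u →
        ∫⁻ x, u x = ∫⁻ t, ∫⁻ x, u (e.symm (t, x)) := by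
      intro u hu
      rw [← he.lintegral_comp hu, Measure.volume_eq_prod, lintegral_prod]
      exact (hu.comp e.symm.measurable).aemeasurable
    have mm : ∀ u : (Fin (n + 1) → ℝ) → ℝ≥0∞, Measurable u → ∀ t,
        Measurable fun x => u (e.symm (t, x)) := fun u hu t =>
      (hu.comp e.symm.measurable).comp measurable_prodMk_left
    rw [fub f hf, fub g hg, fub h hh]
    have ms : ∀ u : (Fin (n + 1) → ℝ) → ℝ≥0∞, Measurable u →
        Measurable fun t => ∫⁻ x, u (e.symm (t, x)) := fun u hu =>
      (hu.comp e.symm.measurable).lintegral_prod_right'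
    -- The fibre integrals satisfy the one-dimensional hypothesis: this is the induction hypothesis
    -- applied to the fibres over `s`, `t` and `(1 - l) s + l t`.
    refine Real.prekopa_leindler h0 h1 (ms f hf) (ms g hg) (ms h hh) fun s t => ?_
    refine ih (mm f hf s) (mm g hg t) (mm h hh _) fun x y => ?_
    refine (hfgh _ _).trans (le_of_eq (congrArg h ?_))
    ext i
    refine Fin.cases ?_ (fun j => ?_) i <;> simp [e]

/-- The multiplicative Brunn–Minkowski inequality. -/
theorem EuclideanSpace.volume_rpow_mul_volume_rpow_le {n : ℕ}
    {A B C : Set (EuclideanSpace ℝ (Fin n))}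
    {l : ℝ} (h0 : 0 < l) (h1 : l < 1) (hA : MeasurableSet A) (hB : MeasurableSet B)
    (hC : MeasurableSet C) (hABC : ∀ a ∈ A, ∀ b ∈ B, (1 - l) • a + l • b ∈ C) :
    volume A ^ (1 - l) * volume B ^ l ≤ volume C := by
  have h1' : 0 < 1 - l := by linarith
  have hp := (PiLp.volume_preserving_toLp (Fin n))
  have hv : ∀ S : Set (EuclideanSpace ℝ (Fin n)), MeasurableSet S →
      volume S = ∫⁻ x, (WithLp.toLp 2 ⁻¹' S).indicator (fun _ => (1 : ℝ≥0∞)) x := by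
    intro S hS
    rw [lintegral_indicator (hp.measurable hS), setLIntegral_one,
      hp.measure_preimage hS.nullMeasurableSet]
  rw [hv A hA, hv B hB, hv C hC]
  refine prekopa_leindler h0 h1 (measurable_const.indicator (hp.measurable hA))
    (measurable_const.indicator (hp.measurable hB))
    (measurable_const.indicator (hp.measurable hC)) fun x y => ?_
  by_cases hx : WithLp.toLp 2 x ∈ A
  · by_cases hy : WithLp.toLp 2 y ∈ B
    · have := hABC _ hx _ hy
      rw [Set.indicator_of_mem (by exact hx), Set.indicator_of_mem (by exact hy),
        Set.indicator_of_mem (by simpa using this)]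
      simp
    · rw [Set.indicator_of_notMem (s := WithLp.toLp 2 ⁻¹' B) hy, ENNReal.zero_rpow_of_pos h0]; simp
  · rw [Set.indicator_of_notMem (by exact hx), ENNReal.zero_rpow_of_pos h1']; simp

/-! ### Grünbaum's inequality -/

section LogConcaveDistribution

variable {ν : Measure ℝ} [IsProbabilityMeasure ν]

/-- With `F t = ν (Iic t)`, a compact subset of `{F < c}` has a largest element `k`, so its mass is
at most `F k < c`. Thus `F` dominates a uniform variable stochastically. -/
theorem measure_setOf_measureReal_Iic_lt_le (c : ℝ) :
    ν {t | ν.real (Set.Iic t) < c} ≤ ENNReal.ofReal c := by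
  by_contra! h
  have hmono : Monotone fun t => ν.real (Set.Iic t) := fun s t hst =>
    measureReal_mono (Set.Iic_subset_Iic.2 hst)
  have hm : MeasurableSet {t | ν.real (Set.Iic t) < c} :=
    measurableSet_lt hmono.measurable measurable_const
  obtain ⟨K, hK, hKc, hlt⟩ := hm.exists_lt_isCompact h
  obtain ⟨k, hk, hk'⟩ := hKc.exists_isGreatest
    (nonempty_of_measure_ne_zero (bot_lt_iff_ne_bot.1 (bot_le.trans_lt hlt)))
  have h1 : ν.real (Set.Iic k) < c := hK hk
  have h2 : ν K ≤ ν (Set.Iic k) := measure_mono fun x hx => hk' hx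
  have h3 : ν (Set.Iic k) ≤ ENNReal.ofReal c := by
    rw [← ENNReal.ofReal_toReal (measure_ne_top ν (Set.Iic k))]
    exact ENNReal.ofReal_le_ofReal h1.le
  exact absurd (hlt.trans_le (h2.trans h3)) (lt_irrefl _)

theorem ae_measureReal_Iic_pos : ∀ᵐ t ∂ν, 0 < ν.real (Set.Iic t) := by
  rw [ae_iff]
  refine le_antisymm (le_of_forall_gt fun c hc => ?_) zero_le
  obtain ⟨b, hb0, hbc⟩ := ENNReal.lt_iff_exists_real_btwn.1 hc
  have hb1 : 0 < b := by simpa using hbc.1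
  refine lt_of_le_of_lt (le_trans (measure_mono fun t ht => ?_)
    (measure_setOf_measureReal_Iic_lt_le b)) hbc.2
  simp only [not_lt, Set.mem_ofPred_eq] at ht ⊢
  linarith

/-- The tail of `-log F` at `r` is the mass of `{F < exp (-r)}`, hence at most `exp (-r)`, which
integrates to `1`. The convention `log 0 = 0` can only lower the left side. -/
theorem lintegral_neg_log_measureReal_Iic_le :
    ∫⁻ t, ENNReal.ofReal (-Real.log (ν.real (Set.Iic t))) ∂ν ≤ 1 := by
  have hmono : Monotone fun t => ν.real (Set.Iic t) := fun s t hst =>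
    measureReal_mono (Set.Iic_subset_Iic.2 hst)
  rw [lintegral_eq_lintegral_meas_lt ν (Filter.Eventually.of_forall fun t => by
      simpa using Real.log_nonpos measureReal_nonneg measureReal_le_one)
      (show Measurable fun t => -Real.log (ν.real (Set.Iic t)) from
        (Real.measurable_log.comp hmono.measurable).neg).aemeasurable]
  have h1 : ∫⁻ r in Set.Ioi (0 : ℝ), ENNReal.ofReal (Real.exp (-r)) = 1 := by
    rw [← ofReal_integral_eq_lintegral_ofReal (integrableOn_exp_neg_Ioi 0)
      (Filter.Eventually.of_forall fun r => (Real.exp_pos _).le), integral_exp_neg_Ioi_zero]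
    simp
  rw [← h1]
  refine setLIntegral_mono (by fun_prop) fun r hr => ?_
  refine le_trans (measure_mono fun t ht => ?_) (measure_setOf_measureReal_Iic_lt_le _)
  simp only [Set.mem_ofPred_eq] at ht ⊢
  have hr0 : (0 : ℝ) < r := hr
  rcases eq_or_lt_of_le (measureReal_nonneg : 0 ≤ ν.real (Set.Iic t)) with h0 | h0
  · rw [← h0]; exact Real.exp_pos _
  · rw [← Real.log_lt_iff_lt_exp h0]; linarith

theorem integrable_log_measureReal_Iic :
    Integrable (fun t => Real.log (ν.real (Set.Iic t))) ν := by
  have hmono : Monotone fun t => ν.real (Set.Iic t) := fun s t hst =>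
    measureReal_mono (Set.Iic_subset_Iic.2 hst)
  rw [← integrable_neg_iff]
  refine ⟨(Real.measurable_log.comp hmono.measurable).neg.aestronglyMeasurable, ?_⟩
  rw [hasFiniteIntegral_iff_ofReal (Filter.Eventually.of_forall fun t => by
      simpa using Real.log_nonpos measureReal_nonneg measureReal_le_one)]
  exact lintegral_neg_log_measureReal_Iic_le.trans_lt ENNReal.one_lt_top

theorem neg_one_le_integral_log_measureReal_Iic :
    -1 ≤ ∫ t, Real.log (ν.real (Set.Iic t)) ∂ν := by
  have h0 : ∀ t, 0 ≤ -Real.log (ν.real (Set.Iic t)) := fun t => by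
    simpa using Real.log_nonpos measureReal_nonneg measureReal_le_one
  have h := lintegral_neg_log_measureReal_Iic_le (ν := ν)
  have hi : Integrable (fun t => -Real.log (ν.real (Set.Iic t))) ν :=
    integrable_log_measureReal_Iic.neg
  rw [← ofReal_integral_eq_lintegral_ofReal hi
    (Filter.Eventually.of_forall h0), ENNReal.ofReal_le_one, integral_neg] at h
  linarith

/-- The right derivative serves as slope of the supporting line; to the left of `m` it suffices that
the left derivative is no larger. -/
theorem ConvexOn.exists_forall_add_mul_sub_le {S : Set ℝ} {g : ℝ → ℝ} (hg : ConvexOn ℝ S g) {m : ℝ}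
    (hm : m ∈ interior S) : ∃ s, ∀ t ∈ S, g m + s * (t - m) ≤ g t := by
  refine ⟨derivWithin g (Set.Ioi m) m, fun t ht => ?_⟩
  rcases lt_trichotomy t m with h | h | h
  · have h1 := (hg.slope_le_leftDeriv_of_mem_interior ht hm h).trans
      (hg.leftDeriv_le_rightDeriv_of_mem_interior hm)
    rw [slope_def_field, div_le_iff₀ (by linarith)] at h1
    linarith
  · simp [h]
  · have h1 := hg.rightDeriv_le_slope_of_mem_interior hm ht h
    rw [slope_def_field, le_div_iff₀ (by linarith)] at h1
    linarith

/-- A distribution on the line with log-concave distribution function puts mass at least `1 / e` on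
the points below its mean. -/
theorem exp_neg_one_le_measureReal_Iic_integral [NullSingletonClass ν] (hint : Integrable (fun x => x) ν)
    (hlc : ∀ s t l : ℝ, 0 < l → l < 1 → ν.real (Set.Iic s) ^ (1 - l) * ν.real (Set.Iic t) ^ l ≤
      ν.real (Set.Iic ((1 - l) * s + l * t))) :
    Real.exp (-1) ≤ ν.real (Set.Iic (∫ x, x ∂ν)) := by
  set m := ∫ x, x ∂ν with hm
  set S : Set ℝ := {t | 0 < ν.real (Set.Iic t)} with hS
  have hmono : ∀ {s t : ℝ}, s ≤ t → ν.real (Set.Iic s) ≤ ν.real (Set.Iic t) := fun hst =>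
    measureReal_mono (Set.Iic_subset_Iic.2 hst)
  -- A supporting line at `m` needs `m` in the interior of `{F > 0}`. Otherwise the variable would
  -- be almost surely at least its mean, hence constant, contradicting the absence of atoms.
  have hmS : ∃ t < m, t ∈ S := by
    by_contra! h
    have h1 : ∀ᵐ t ∂ν, 0 ≤ t - m := by
      filter_upwards [ae_measureReal_Iic_pos (ν := ν)] with t ht
      by_contra! h'
      exact h t (by linarith) ht
    have hi : Integrable (fun t => t - m) ν := hint.sub (integrable_const m)
    have h2 : ∫ t, (t - m) ∂ν = 0 := by
      rw [integral_sub hint (integrable_const m)]; simp [hm]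
    have h3 := (integral_eq_zero_iff_of_nonneg_ae h1 hi).1 h2
    have h4 : ν {m}ᶜ = 0 := by
      refine measure_mono_null ?_ (ae_iff.1 h3)
      intro t ht h'
      exact ht (by simpa [sub_eq_zero] using h')
    have h5 : ν Set.univ ≤ 0 := by
      rw [← Set.union_compl_self {m}]
      exact (measure_union_le _ _).trans (by simp [h4])
    simp at h5
  have hmi : m ∈ interior S := by
    obtain ⟨t, ht, htS⟩ := hmS
    refine mem_interior.2 ⟨Set.Ioi t, fun x hx => ?_, isOpen_Ioi, ht⟩
    exact lt_of_lt_of_le htS (hmono (le_of_lt hx))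
  have hconv : ConvexOn ℝ S fun t => -Real.log (ν.real (Set.Iic t)) := by
    have key : ∀ s t l : ℝ, s ∈ S → t ∈ S → 0 < l → l < 1 → (1 - l) * s + l * t ∈ S ∧
        (1 - l) * Real.log (ν.real (Set.Iic s)) + l * Real.log (ν.real (Set.Iic t)) ≤
          Real.log (ν.real (Set.Iic ((1 - l) * s + l * t))) := by
      intro s t l hs ht h0 h1
      have hp : 0 < ν.real (Set.Iic s) ^ (1 - l) * ν.real (Set.Iic t) ^ l :=
        mul_pos (Real.rpow_pos_of_pos hs _) (Real.rpow_pos_of_pos ht _)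
      refine ⟨hp.trans_le (hlc s t l h0 h1), ?_⟩
      have := Real.log_le_log hp (hlc s t l h0 h1)
      rwa [Real.log_mul (Real.rpow_pos_of_pos hs _).ne' (Real.rpow_pos_of_pos ht _).ne',
        Real.log_rpow hs, Real.log_rpow ht] at this
    refine ⟨fun s hs t ht a b ha hb hab => ?_, fun s hs t ht a b ha hb hab => ?_⟩
    all_goals
      obtain rfl : a = 1 - b := by linarith
      rcases eq_or_lt_of_le hb with rfl | hb'
      · first | (simp; done) | simpa using hs
      rcases eq_or_lt_of_le ha with ha' | ha'
      · obtain rfl : b = 1 := by linarith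
        first | (simp; done) | simpa using ht
      have := key s t b hs ht hb' (by linarith)
    · exact this.1
    · simp only [smul_eq_mul]
      linarith [this.2]
  obtain ⟨s, hs⟩ := hconv.exists_forall_add_mul_sub_le hmi
  have hpos : 0 < ν.real (Set.Iic m) :=
    have h : m ∈ S := interior_subset hmi
    h
  rw [← Real.le_log_iff_exp_le hpos]
  refine (neg_one_le_integral_log_measureReal_Iic (ν := ν)).trans ?_
  have hj : Integrable (fun t => -s * (t - m)) ν := (hint.sub (integrable_const m)).const_mul _
  have hi : Integrable (fun t => Real.log (ν.real (Set.Iic m)) + -s * (t - m)) ν :=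
    (integrable_const _).add hj
  -- Jensen's inequality by hand: the linear part of the supporting line has mean zero.
  calc ∫ t, Real.log (ν.real (Set.Iic t)) ∂ν
      ≤ ∫ t, (Real.log (ν.real (Set.Iic m)) + -s * (t - m)) ∂ν := by
        refine integral_mono_ae integrable_log_measureReal_Iic hi ?_
        filter_upwards [ae_measureReal_Iic_pos (ν := ν)] with t ht
        have := hs t ht
        linarith
    _ = Real.log (ν.real (Set.Iic m)) := by
        rw [integral_add (integrable_const _) hj,
          integral_const_mul, integral_sub hint (integrable_const m)]
        simp [hm]

end LogConcaveDistribution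

/-- Grünbaum's inequality: a half-space that has the centroid of a convex body on its boundary
contains at most the fraction `1 - 1 / e` of the volume. -/
theorem volume_inter_average_le_inner_le {n : ℕ} {W : Set (EuclideanSpace ℝ (Fin n))}
    (hW : Convex ℝ W) (hWc : IsCompact W) (hW0 : volume W ≠ 0) {a : EuclideanSpace ℝ (Fin n)}
    (ha : a ≠ 0) :
    volume (W ∩ {u | inner ℝ (⨍ w in W, w) a ≤ inner ℝ u a}) ≤
      ENNReal.ofReal (1 - Real.exp (-1)) * volume W := by
  have hWt : volume W ≠ ∞ := hWc.measure_lt_top.ne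
  have hWm := hWc.measurableSet
  set X : EuclideanSpace ℝ (Fin n) → ℝ := fun u => inner ℝ u a with hX
  have hXc : Continuous X := by fun_prop
  have hXm : Measurable X := hXc.measurable
  set P : Measure (EuclideanSpace ℝ (Fin n)) := (volume W)⁻¹ • volume.restrict W with hP
  have hPp : IsProbabilityMeasure P := ⟨by simp [hP, ENNReal.inv_mul_cancel hW0 hWt]⟩
  have hint : ∀ {E : Type} [NormedAddCommGroup E] {u : EuclideanSpace ℝ (Fin n) → E},
      Continuous u → Integrable u P := fun hu =>
    (hu.continuousOn.integrableOn_compact hWc).smul_measure (ENNReal.inv_ne_top.2 hW0)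
  set ν := P.map X with hν
  have hνp : IsProbabilityMeasure ν := Measure.isProbabilityMeasure_map hXm.aemeasurable
  -- Hyperplanes are null, being translates of the proper subspace `ker ⟪a, ·⟫`; hence the law of
  -- `X` has no atoms.
  have hlevel : ∀ t, volume {u | X u = t} = 0 := by
    intro t
    have hs : (LinearMap.ker (innerSL ℝ a : EuclideanSpace ℝ (Fin n) →ₗ[ℝ] ℝ)) ≠ ⊤ := by
      intro h
      have : a ∈ LinearMap.ker (innerSL ℝ a : EuclideanSpace ℝ (Fin n) →ₗ[ℝ] ℝ) := h ▸ trivial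
      simp at this
      exact ha this
    by_cases hne : ∃ u, X u = t
    · obtain ⟨u, hu⟩ := hne
      have h0 := Measure.addHaar_submodule volume _ hs
      rw [← measure_preimage_add_right volume (-u)] at h0
      refine measure_mono_null (fun v hv => ?_) h0
      have hv' : X v = t := hv
      simp only [Set.mem_preimage, SetLike.mem_coe, LinearMap.mem_ker, ContinuousLinearMap.coe_coe,
        innerSL_apply_apply, real_inner_comm _ a, inner_add_left, inner_neg_left]
      simp only [hX] at hu hv'
      rw [hu, hv', add_neg_cancel]
    · push Not at hne
      simp [hne]
  have hna : NullSingletonClass ν := ⟨fun t => by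
    rw [hν, Measure.map_apply hXm (measurableSet_singleton t), hP, Measure.smul_apply,
      Measure.restrict_apply (hXm (measurableSet_singleton t))]
    rw [measure_mono_null (s := X ⁻¹' {t} ∩ W) Set.inter_subset_left (hlevel t)]
    simp⟩
  have hνI : ∀ t, ν (Set.Iic t) = (volume W)⁻¹ * volume (W ∩ {u | X u ≤ t}) := by
    intro t
    rw [hν, Measure.map_apply hXm measurableSet_Iic, hP, Measure.smul_apply,
      Measure.restrict_apply (hXm measurableSet_Iic), Set.inter_comm]
    rfl
  have hmean : ∫ x, x ∂ν = X (⨍ w in W, w) := by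
    rw [hν, integral_map hXm.aemeasurable (by fun_prop)]
    rw [average, Measure.restrict_apply_univ, ← hP]
    have := (innerSL ℝ a : EuclideanSpace ℝ (Fin n) →L[ℝ] ℝ).integral_comp_comm
      (hint continuous_id)
    simp only [innerSL_apply_apply, id] at this
    simp only [hX, real_inner_comm a]
    exact this
  have hge := exp_neg_one_le_measureReal_Iic_integral (ν := ν) (by
      rw [hν]
      exact (integrable_map_measure (by fun_prop) hXm.aemeasurable).2 (hint hXc)) (by
    intro s t l h0 h1
    have h1' : 0 < 1 - l := by linarith
    have hcl : ∀ t, MeasurableSet (W ∩ {u | X u ≤ t}) := fun t =>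
      hWm.inter (measurableSet_le hXm measurable_const)
    -- Log-concavity of the distribution function: by convexity of `W`, the slices `W ∩ {X ≤ t}`
    -- combine as Brunn–Minkowski requires.
    have hbm := EuclideanSpace.volume_rpow_mul_volume_rpow_le h0 h1 (hcl s) (hcl t)
      (hcl ((1 - l) * s + l * t)) (by
        rintro u ⟨huW, hu⟩ v ⟨hvW, hv⟩
        refine ⟨hW huW hvW h1'.le h0.le (by ring), ?_⟩
        simp only [hX, Set.mem_ofPred_eq, inner_add_left, inner_smul_left] at hu hv ⊢
        simp only [conj_trivial]
        gcongr)
    simp only [measureReal_def]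
    rw [ENNReal.toReal_rpow, ENNReal.toReal_rpow, ← ENNReal.toReal_mul]
    refine ENNReal.toReal_mono (measure_ne_top _ _) ?_
    rw [hνI, hνI, hνI, ENNReal.mul_rpow_of_nonneg _ _ h1'.le, ENNReal.mul_rpow_of_nonneg _ _ h0.le,
      mul_mul_mul_comm, ← ENNReal.rpow_add _ _ (ENNReal.inv_ne_zero.2 hWt)
        (ENNReal.inv_ne_top.2 hW0)]
    simp only [sub_add_cancel, ENNReal.rpow_one]
    gcongr)
  rw [hmean] at hge
  set m := X (⨍ w in W, w)
  have hio : ν (Set.Ici m) ≤ ENNReal.ofReal (1 - Real.exp (-1)) := by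
    rw [← measure_congr (Ioi_ae_eq_Ici (μ := ν) (a := m)), ← Set.compl_Iic,
      prob_compl_eq_one_sub measurableSet_Iic,
      ENNReal.ofReal_sub _ (Real.exp_pos _).le, ENNReal.ofReal_one]
    gcongr
    exact ENNReal.ofReal_le_of_le_toReal hge
  have : ν (Set.Ici m) = (volume W)⁻¹ * volume (W ∩ {u | m ≤ X u}) := by
    rw [hν, Measure.map_apply hXm measurableSet_Ici, hP, Measure.smul_apply,
      Measure.restrict_apply (hXm measurableSet_Ici), Set.inter_comm]
    rfl
  rw [this, mul_comm, ← div_eq_mul_inv] at hio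
  exact (ENNReal.div_le_iff hW0 hWt).1 hio

namespace OnlineBandit

/-! ### Coordinates with respect to a spanner -/

section Spanner

variable {d : ℕ} {q : Fin d → Vec d}

/-- The coordinates `M⁻¹ x` of `x` with respect to the spanner. -/
def spannerCoord (q : Fin d → Vec d) : Vec d →ₗ[ℝ] Vec d :=
  Matrix.toLpLin 2 2 (spannerMatrix q)⁻¹

/-- `Q⁻¹` as a linear map. -/
theorem applyQinv_eq (q : Fin d → Vec d) (x : Vec d) :
    applyQinv q x = Matrix.toLpLin 2 2 (gramQ q)⁻¹ x := rfl

theorem isUnit_det_spannerMatrix (hq : LinearIndependent ℝ q) : IsUnit (spannerMatrix q).det := by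
  have h : LinearIndependent ℝ (fun c => WithLp.linearEquiv 2 ℝ (Fin d → ℝ) (q c)) :=
    hq.map' (WithLp.linearEquiv 2 ℝ (Fin d → ℝ)).toLinearMap (LinearEquiv.ker _)
  rw [← Matrix.isUnit_iff_isUnit_det, ← Matrix.linearIndependent_cols_iff_isUnit]
  exact h

theorem sum_smul_eq_toLp_mulVec (b : Fin d → ℝ) :
    ∑ i, b i • q i = WithLp.toLp 2 ((spannerMatrix q).mulVec b) := by
  ext j
  simp [Matrix.mulVec, dotProduct, spannerMatrix, mul_comm]

theorem sum_spannerCoord_smul (hq : LinearIndependent ℝ q) (x : Vec d) :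
    ∑ i, spannerCoord q x i • q i = x := by
  rw [sum_smul_eq_toLp_mulVec]
  simp [spannerCoord, Matrix.toLpLin_apply, Matrix.mulVec_mulVec,
    Matrix.mul_nonsing_inv _ (isUnit_det_spannerMatrix hq)]

theorem spannerCoord_sum_smul (hq : LinearIndependent ℝ q) (b : Fin d → ℝ) :
    spannerCoord q (∑ i, b i • q i) = WithLp.toLp 2 b := by
  rw [sum_smul_eq_toLp_mulVec]
  simp [spannerCoord, Matrix.mulVec_mulVec,
    Matrix.nonsing_inv_mul _ (isUnit_det_spannerMatrix hq)]

theorem spannerCoord_apply_spanner (hq : LinearIndependent ℝ q) (i : Fin d) :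
    spannerCoord q (q i) = EuclideanSpace.single i 1 := by
  have := spannerCoord_sum_smul hq (Pi.single i 1)
  simpa [Pi.single_apply, ite_smul] using this

theorem spannerCoord_injective (hq : LinearIndependent ℝ q) :
    Function.Injective (spannerCoord q) := fun x y h => by
  rw [← sum_spannerCoord_smul hq x, h, sum_spannerCoord_smul hq y]

/-- Since `Q⁻¹ = (M⁻¹)ᵀ M⁻¹`, the geometry of the regularizer is Euclidean geometry of the
coordinates `M⁻¹ x`. -/
theorem inner_applyQinv (x y : Vec d) :
    inner ℝ x (applyQinv q y) = inner ℝ (spannerCoord q x) (spannerCoord q y) := by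
  simp only [applyQinv, spannerCoord, Matrix.toLpLin_apply, gramQ, Matrix.mul_inv_rev,
    EuclideanSpace.inner_eq_star_dotProduct, star_trivial]
  rw [← Matrix.mulVec_mulVec, dotProduct_comm, Matrix.dotProduct_mulVec,
      ← Matrix.transpose_nonsing_inv,
    Matrix.vecMul_transpose, dotProduct_comm]

theorem applyQinv_injective (hq : LinearIndependent ℝ q) : Function.Injective (applyQinv q) := by
  intro x y h
  have h1 : applyQinv q (x - y) = 0 := by
    rw [applyQinv_eq, map_sub, ← applyQinv_eq, ← applyQinv_eq, h, sub_self]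
  have h2 := inner_applyQinv (q := q) (x - y) (x - y)
  rw [h1, inner_zero_right] at h2
  have h3 := inner_self_eq_zero.1 h2.symm
  rw [← map_zero (spannerCoord q)] at h3
  exact sub_eq_zero.1 (spannerCoord_injective hq h3)

/-- `Q w = ∑ᵢ ⟪qᵢ, w⟫ qᵢ`. -/
def applyQ (q : Fin d → Vec d) (w : Vec d) : Vec d := ∑ i, inner ℝ (q i) w • q i

theorem spannerCoord_applyQ (hq : LinearIndependent ℝ q) (w : Vec d) (i : Fin d) :
    spannerCoord q (applyQ q w) i = inner ℝ (q i) w := by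
  rw [applyQ, spannerCoord_sum_smul hq]

theorem sum_spannerCoord_mul_inner (hq : LinearIndependent ℝ q) (x w : Vec d) :
    ∑ i, spannerCoord q x i * inner ℝ (q i) w = inner ℝ x w := by
  conv_rhs => rw [← sum_spannerCoord_smul hq x]
  simp [sum_inner, inner_smul_left]

theorem inner_spannerCoord_applyQ (hq : LinearIndependent ℝ q) (x w : Vec d) :
    inner ℝ (spannerCoord q x) (spannerCoord q (applyQ q w)) = inner ℝ x w := by
  rw [← sum_spannerCoord_mul_inner hq x w, PiLp.inner_apply]
  simp [spannerCoord_applyQ hq, mul_comm]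

/-- `hᵀ Q w = ∑ᵢ (qᵢᵀ w)(qᵢᵀ h)`. This is what the inclusion of `C` in `(Mᵀ)⁻¹ ℝ₊ᵈ` is for: it makes
the projections monotone against every direction of `C`. -/
theorem inner_applyQ_nonneg {w h : Vec d} (hw : ∀ i, 0 ≤ inner ℝ (q i) w)
    (hh : ∀ i, 0 ≤ inner ℝ (q i) h) : 0 ≤ inner ℝ h (applyQ q w) := by
  rw [applyQ, inner_sum]
  refine Finset.sum_nonneg fun i _ => ?_
  rw [inner_smul_right, real_inner_comm (q i) h]
  exact mul_nonneg (hw i) (hh i)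

theorem inner_nonneg_of_mem_spannerCone (hq : LinearIndependent ℝ q) {w : Vec d}
    (hw : w ∈ spannerCone q) (i : Fin d) : 0 ≤ inner ℝ (q i) w := by
  obtain ⟨u, hu, rfl⟩ := hw
  have hM : IsUnit (spannerMatrix q).transpose.det := by
    rw [Matrix.det_transpose]; exact isUnit_det_spannerMatrix hq
  have h : (spannerMatrix q).transpose.mulVec
      ((spannerMatrix q).transpose⁻¹.mulVec u.ofLp) i = u i := by
    rw [Matrix.mulVec_mulVec, Matrix.mul_nonsing_inv _ hM, Matrix.one_mulVec]
  have h2 : inner ℝ (q i) (WithLp.toLp 2 ((spannerMatrix q).transpose⁻¹.mulVec u.ofLp)) = u i := by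
    rw [← h, PiLp.inner_apply]
    conv_rhs => rw [Matrix.mulVec, dotProduct]
    simp [spannerMatrix, mul_comm]
  change 0 ≤ inner ℝ (q i) (WithLp.toLp 2 ((spannerMatrix q).transpose⁻¹.mulVec u.ofLp))
  rw [h2]
  exact hu i

/-- Triangle inequality in `x = ∑ᵢ xᵢ qᵢ`, then Cauchy–Schwarz, which costs the factor `d`. -/
theorem norm_sq_le_mul_norm_spannerCoord_sq (hq : LinearIndependent ℝ q) {R : ℝ}
    (hR : ∀ i, ‖q i‖ ≤ R) (x : Vec d) : ‖x‖ ^ 2 ≤ d * R ^ 2 * ‖spannerCoord q x‖ ^ 2 := by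
  have h1 : ‖x‖ ≤ ∑ i, |spannerCoord q x i| * R := by
    conv_lhs => rw [← sum_spannerCoord_smul hq x]
    refine (norm_sum_le _ _).trans (Finset.sum_le_sum fun i _ => ?_)
    rw [norm_smul, Real.norm_eq_abs]
    gcongr
    exact hR i
  calc ‖x‖ ^ 2 ≤ (∑ i, |spannerCoord q x i| * R) ^ 2 := by gcongr
    _ = R ^ 2 * (∑ i, |spannerCoord q x i|) ^ 2 := by rw [← Finset.sum_mul]; ring
    _ ≤ R ^ 2 * (d * ∑ i, |spannerCoord q x i| ^ 2) := by
        gcongr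
        simpa using sq_sum_le_card_mul_sum_sq (s := Finset.univ)
          (f := fun i => |spannerCoord q x i|)
    _ = d * R ^ 2 * ‖spannerCoord q x‖ ^ 2 := by
        rw [EuclideanSpace.norm_sq_eq]
        simp only [Real.norm_eq_abs]
        ring

theorem IsBarycentricSpanner.norm_spannerCoord_sq_le {β : ℝ} {K : Set (Vec d)}
    (h : IsBarycentricSpanner β q K) {x : Vec d} (hx : x ∈ K) :
    ‖spannerCoord q x‖ ^ 2 ≤ β ^ 2 * d := by
  obtain ⟨b, hb, rfl⟩ := h.exists_coeff x hx
  rw [spannerCoord_sum_smul h.linearIndependent, EuclideanSpace.norm_sq_eq]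
  calc ∑ i, ‖b i‖ ^ 2 ≤ ∑ _i : Fin d, β ^ 2 := by
        refine Finset.sum_le_sum fun i _ => ?_
        rw [Real.norm_eq_abs, sq_abs]
        exact sq_le_sq' (hb i).1 (hb i).2
    _ = β ^ 2 * d := by simp [mul_comm]

/-- Coordinates are unique, and `q₀ ∈ K` has a coordinate equal to `1`, which must lie in `[-β, β]`.
-/
theorem IsBarycentricSpanner.one_le [NeZero d] {β : ℝ} {K : Set (Vec d)}
    (h : IsBarycentricSpanner β q K) : 1 ≤ β := by
  obtain ⟨b, hb, hqb⟩ := h.exists_coeff _ (h.mem 0)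
  have h1 := congrArg (fun x => spannerCoord q x 0) hqb
  simp only [spannerCoord_apply_spanner h.linearIndependent,
    spannerCoord_sum_smul h.linearIndependent] at h1
  simp at h1
  rw [h1]
  exact (hb 0).2

/-! ### The barycentric regularizer -/

theorem barycentricRegularizer_eq (x : Vec d) :
    barycentricRegularizer q x = 1 / 2 * ‖spannerCoord q x‖ ^ 2 := by
  rw [barycentricRegularizer, inner_applyQinv, real_inner_self_eq_norm_sq]

theorem hasGradientAt_barycentricRegularizer (x : Vec d) :
    HasGradientAt (barycentricRegularizer q) (applyQinv q x) x := by
  have hc : HasFDerivAt (spannerCoord q) (LinearMap.toContinuousLinearMap (spannerCoord q)) x :=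
    (LinearMap.toContinuousLinearMap (spannerCoord q)).hasFDerivAt
  have h := (hc.norm_sq).const_mul (1 / 2 : ℝ)
  have he : barycentricRegularizer q = fun x => 1 / 2 * ‖spannerCoord q x‖ ^ 2 :=
    funext barycentricRegularizer_eq
  rw [he, hasGradientAt_iff_hasFDerivAt]
  refine h.congr_fderiv (ContinuousLinearMap.ext fun v => ?_)
  rw [InnerProductSpace.toDual_apply_apply, real_inner_comm, inner_applyQinv, real_inner_comm]
  simp

theorem gradient_barycentricRegularizer (x : Vec d) :
    gradient (barycentricRegularizer q) x = applyQinv q x :=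
  (hasGradientAt_barycentricRegularizer x).gradient

theorem bregman_barycentricRegularizer (x y : Vec d) :
    bregman (barycentricRegularizer q) x y = 1 / 2 * ‖spannerCoord q (x - y)‖ ^ 2 := by
  rw [bregman, gradient_barycentricRegularizer, real_inner_comm, inner_applyQinv,
    barycentricRegularizer_eq, barycentricRegularizer_eq, map_sub, norm_sub_sq_real,
    inner_sub_left, real_inner_self_eq_norm_sq]
  ring

/-- A strict minimizer is the only one, so the arbitrary choice in `argminOn` must return it. -/
theorem argminOn_eq {f : Vec d → ℝ} {S : Set (Vec d)} {z : Vec d} (hz : z ∈ S)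
    (hmin : ∀ x ∈ S, x ≠ z → f z < f x) : argminOn f S = z := by
  have hex : ∃ x, x ∈ S ∧ IsMinOn f S x := ⟨z, hz, fun x hx => by
    by_cases h : x = z
    · simp [h]
    · exact (hmin x hx h).le⟩
  obtain ⟨h1, h2⟩ := Classical.epsilon_spec hex
  by_contra hne
  exact absurd (h2 hz) (not_le.2 (hmin _ h1 hne))

theorem argminOn_barycentricRegularizer (hq : LinearIndependent ℝ q) :
    argminOn (barycentricRegularizer q) Set.univ = 0 := by
  refine argminOn_eq trivial fun x _ hx => ?_
  rw [barycentricRegularizer_eq, barycentricRegularizer_eq, map_zero, norm_zero]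
  have : spannerCoord q x ≠ 0 := fun h => hx (spannerCoord_injective hq (by rw [h, map_zero]))
  have := pow_pos (norm_pos_iff.2 this) 2
  linarith

/-- The Bregman projection onto a half-space moves along `Q w` and satisfies the Pythagorean
inequality. -/
theorem argminOn_bregman_halfSpace (hq : LinearIndependent ℝ q) (w v z : Vec d) :
    ∃ l : ℝ, 0 ≤ l ∧
      argminOn (fun x => bregman (barycentricRegularizer q) x z) {x | 0 ≤ inner ℝ w (x - v)} =
        z + l • applyQ q w ∧
      0 ≤ inner ℝ w (z + l • applyQ q w - v) ∧
      ∀ x, 0 ≤ inner ℝ w (x - v) →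
        ‖spannerCoord q (x - (z + l • applyQ q w))‖ ^ 2 ≤ ‖spannerCoord q (x - z)‖ ^ 2 := by
  set n := ‖spannerCoord q (applyQ q w)‖ ^ 2 with hn
  have hnw : inner ℝ w (applyQ q w) = n := by
    rw [real_inner_comm, ← inner_spannerCoord_applyQ hq, real_inner_self_eq_norm_sq]
  -- Either `z` is already in the half-space and `l = 0`, or `l` carries `z` exactly to the
  -- boundary. In the second case `n = wᵀ Q w` is positive: `n = 0` would force `⟪z - v, w⟫ = 0`.
  obtain ⟨l, hl0, hlm, hl1⟩ : ∃ l : ℝ, 0 ≤ l ∧ 0 ≤ inner ℝ w (z + l • applyQ q w - v) ∧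
      (l = 0 ∨ inner ℝ w (z + l • applyQ q w - v) = 0) := by
    by_cases hz : 0 ≤ inner ℝ w (z - v)
    · exact ⟨0, le_rfl, by simpa using hz, Or.inl rfl⟩
    · push Not at hz
      have hn0 : n ≠ 0 := by
        intro h
        have h1 : spannerCoord q (applyQ q w) = 0 := by simpa [hn] using h
        have h2 := inner_spannerCoord_applyQ hq (z - v) w
        rw [h1, inner_zero_right, real_inner_comm] at h2
        linarith
      have hnp : 0 < n := lt_of_le_of_ne (by positivity) hn0.symm
      have h0 : inner ℝ w (z + (-inner ℝ w (z - v) / n) • applyQ q w - v) = 0 := by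
        rw [add_sub_right_comm, inner_add_right, inner_smul_right, hnw]
        field_simp
        ring
      exact ⟨_, div_nonneg (by linarith) hnp.le, h0.ge, Or.inr h0⟩
  set z' := z + l • applyQ q w with hz'
  have hpy : ∀ x, 0 ≤ inner ℝ w (x - v) →
      ‖spannerCoord q (x - z')‖ ^ 2 + ‖spannerCoord q (z' - z)‖ ^ 2 ≤
        ‖spannerCoord q (x - z)‖ ^ 2 := by
    intro x hx
    have h1 : spannerCoord q (x - z) = spannerCoord q (x - z') + spannerCoord q (z' - z) := by
      rw [← map_add]; congr 1; abel
    have h2 : z' - z = l • applyQ q w := by rw [hz']; abel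
    -- The cross term is `l ⟪w, x - z'⟫`: it vanishes if `l = 0`; otherwise `z'` is on the boundary
    -- and `x` on its inner side.
    have h3 : 0 ≤ inner ℝ (spannerCoord q (x - z')) (spannerCoord q (z' - z)) := by
      rw [h2, map_smul, inner_smul_right, inner_spannerCoord_applyQ hq, real_inner_comm]
      rcases hl1 with h | h
      · simp [h]
      · have : x - z' = (x - v) - (z' - v) := by abel
        rw [this, inner_sub_right, h, sub_zero]
        exact mul_nonneg hl0 hx
    rw [h1, norm_add_sq_real]
    linarith
  refine ⟨l, hl0, argminOn_eq hlm fun x hx hxz => ?_, hlm, fun x hx => ?_⟩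
  · simp only [bregman_barycentricRegularizer]
    have h1 := hpy x hx
    have h2 : 0 < ‖spannerCoord q (x - z')‖ := norm_pos_iff.2 fun h =>
      hxz (sub_eq_zero.1 (spannerCoord_injective hq (by rw [h, map_zero])))
    have h3 := pow_pos h2 2
    linarith
  · have h1 := hpy x hx
    have h2 := sq_nonneg ‖spannerCoord q (z' - z)‖
    linarith

end Spanner

end OnlineBandit

namespace OnlineBandit

/-! ### The projection-and-decomposition procedure -/

section PAD

variable {d : ℕ} {q : Fin d → Vec d}

theorem padState_snd_subset (D : OMDData d) (y : Vec d) (i : ℕ) :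
    (padState D y i).2 ⊆ (D.cone : Set (Vec d)) ∩ Metric.closedBall 0 1 := by
  induction i with
  | zero => exact subset_rfl
  | succ i ih =>
    rw [padState, Function.iterate_succ_apply']
    exact Set.inter_subset_left.trans ih

theorem convex_padState_snd (D : OMDData d) (y : Vec d) (i : ℕ) : Convex ℝ (padState D y i).2 := by
  induction i with
  | zero => exact D.cone.convex.inter (convex_closedBall _ _)
  | succ i ih =>
    rw [padState, Function.iterate_succ_apply']
    refine ih.inter ?_
    intro u hu v hv a b ha hb _
    have hu' : 0 ≤ inner ℝ u _ := hu
    have hv' : 0 ≤ inner ℝ v _ := hv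
    simp only [Set.mem_ofPred_eq, inner_add_left, inner_smul_left, conj_trivial]
    exact add_nonneg (mul_nonneg ha hu') (mul_nonneg hb hv')

theorem isCompact_padState_snd (D : OMDData d) (y : Vec d) (i : ℕ)
    : IsCompact (padState D y i).2 := by
  induction i with
  | zero => exact (isCompact_closedBall _ _).inter_left D.cone.isClosed
  | succ i ih =>
    rw [padState, Function.iterate_succ_apply']
    exact ih.inter_right (isClosed_le continuous_const (by fun_prop))

theorem centroid_mem (D : OMDData d) (y : Vec d) (i : ℕ)
    : centroid (padState D y i).2 ∈ D.cone := by
  by_cases h : volume (padState D y i).2 = 0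
  · rw [centroid, Measure.restrict_eq_zero.2 h, average_zero_measure]
    exact zero_mem _
  · have hc := isCompact_padState_snd D y i
    refine D.cone.convex.set_average_mem D.cone.isClosed h hc.measure_lt_top.ne ?_
      (continuous_id.continuousOn.integrableOn_compact hc)
    exact ae_restrict_of_forall_mem hc.measurableSet
      fun x hx => (padState_snd_subset D y i hx).1

/-- The standing assumptions on the data handed to the projection-and-decomposition procedure. -/
structure IsSpannerInstance (D : OMDData d) (K : Set (Vec d)) (q : Fin d → Vec d) (R α β : ℝ) :
    Prop where
  reg : D.reg = barycentricRegularizer q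
  radius : D.radius = α * R
  tol_pos : 0 < D.tol
  tol_le : D.tol ≤ α * R
  nonneg : K ⊆ orthant d
  R_pos : 0 < R
  norm_le : ∀ x ∈ K, ‖x‖ ≤ R
  one_le : 1 ≤ α
  spanner : IsBarycentricSpanner β q K
  orthant_subset : orthant d ⊆ D.cone
  cone_subset : (D.cone : Set (Vec d)) ⊆ spannerCone q
  oracle_mem : ∀ w ∈ D.cone, D.oracle w ∈ K
  oracle_le : ∀ w ∈ D.cone, ∀ x ∈ K, inner ℝ w (D.oracle w) ≤ α * inner ℝ w x
  pick_mem : ∀ (k : ℕ) (S : Set (Fin k → ℝ)), S.Nonempty → D.pick k S ∈ S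

namespace IsSpannerInstance

variable {D : OMDData d} {K : Set (Vec d)} {R α β : ℝ}

theorem linearIndependent (hD : IsSpannerInstance D K q R α β)
    : LinearIndependent ℝ q := hD.spanner.linearIndependent

theorem inner_spanner_nonneg (hD : IsSpannerInstance D K q R α β) {w : Vec d} (hw : w ∈ D.cone)
    (i : Fin d) : 0 ≤ inner ℝ (q i) w :=
  inner_nonneg_of_mem_spannerCone hD.linearIndependent (hD.cone_subset hw) i

theorem padAtom_mem (hD : IsSpannerInstance D K q R α β) (y : Vec d) (i : ℕ) : padAtom D y i ∈ K :=
  hD.oracle_mem _ (centroid_mem D y i)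

theorem padState_succ (hD : IsSpannerInstance D K q R α β) (y : Vec d) (i : ℕ) : ∃ l : ℝ, 0 ≤ l ∧
    (padState D y (i + 1)).1 = (padState D y i).1 + l • applyQ q (centroid (padState D y i).2) ∧
    0 ≤ inner ℝ (centroid (padState D y i).2) ((padState D y (i + 1)).1 - padAtom D y i) ∧
    (∀ x, 0 ≤ inner ℝ (centroid (padState D y i).2) (x - padAtom D y i) →
      ‖spannerCoord q (x - (padState D y (i + 1)).1)‖ ^ 2 ≤
        ‖spannerCoord q (x - (padState D y i).1)‖ ^ 2) ∧
    (padState D y (i + 1)).2 = (padState D y i).2 ∩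
      {u | 0 ≤ inner ℝ u (padAtom D y i - (padState D y (i + 1)).1)} := by
  obtain ⟨l, hl, h1, h2, h3⟩ := argminOn_bregman_halfSpace hD.linearIndependent
    (centroid (padState D y i).2) (padAtom D y i) (padState D y i).1
  have hs : padState D y (i + 1) = padStep D (padState D y i) := by
    rw [padState, Function.iterate_succ_apply', padState]
  have hz : (padState D y (i + 1)).1 =
      (padState D y i).1 + l • applyQ q (centroid (padState D y i).2) := by
    rw [← h1, hs, ← hD.reg]
    rfl
  refine ⟨l, hl, hz, hz ▸ h2, fun x hx => hz ▸ h3 x hx, ?_⟩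
  rw [hs]
  rfl

/-- The oracle's guarantee `wᵀ v ≤ α wᵀ x` puts `α x` into every half-space used, so each projection
brings the point no farther from `α x`. -/
theorem norm_spannerCoord_padState_sub_le (hD : IsSpannerInstance D K q R α β) {x : Vec d}
    (hx : x ∈ K) (y : Vec d) (i : ℕ) :
    ‖spannerCoord q ((padState D y i).1 - α • x)‖ ^ 2 ≤ ‖spannerCoord q (y - α • x)‖ ^ 2 := by
  induction i with
  | zero => exact le_rfl
  | succ i ih =>
    obtain ⟨l, -, -, -, h, -⟩ := hD.padState_succ y i
    refine le_trans ?_ ih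
    rw [← neg_sub, map_neg, norm_neg, ← neg_sub (α • x), map_neg, norm_neg]
    refine h _ ?_
    rw [inner_sub_right, inner_smul_right, sub_nonneg]
    exact hD.oracle_le _ (centroid_mem D y i) x hx

/-- Each pass adds a non-negative multiple of `Q w` with `w ∈ C`. Consequently a direction that
separates the last point from the atoms also satisfies the cuts made at earlier points. -/
theorem inner_padState_mono (hD : IsSpannerInstance D K q R α β) {h : Vec d} (hh : h ∈ D.cone)
    (y : Vec d) :
    Monotone fun i => inner ℝ h (padState D y i).1 := by
  refine monotone_nat_of_le_succ fun i => ?_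
  obtain ⟨l, hl, hz, -⟩ := hD.padState_succ y i
  rw [hz, inner_add_right, inner_smul_right]
  have := inner_applyQ_nonneg (hD.inner_spanner_nonneg (centroid_mem D y i))
    (hD.inner_spanner_nonneg hh)
  have := mul_nonneg hl this
  linarith

theorem mem_padState_snd (hD : IsSpannerInstance D K q R α β) (y : Vec d) {u : Vec d}
    (hu : u ∈ D.cone) (hu1 : ‖u‖ ≤ 1) {k : ℕ}
    (h : ∀ i < k, 0 ≤ inner ℝ u (padAtom D y i - (padState D y (i + 1)).1)) :
    u ∈ (padState D y k).2 := by
  induction k with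
  | zero => exact ⟨hu, by simpa using hu1⟩
  | succ k ih =>
    obtain ⟨l, -, -, -, -, hW⟩ := hD.padState_succ y k
    rw [hW]
    exact ⟨ih fun i hi => h i (by omega), h k (by omega)⟩

/-- The new point satisfies `⟪w, v - zᵢ₊₁⟫ ≤ 0` at the centroid `w`, so the part kept lies in a
half-space with the centroid on its boundary, and Grünbaum's inequality applies. The normal vector
must not vanish, hence `hne`. -/
theorem volume_padState_succ_le (hD : IsSpannerInstance D K q R α β) (y : Vec d) (i : ℕ)
    (hne : padAtom D y i ≠ (padState D y (i + 1)).1) :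
    volume (padState D y (i + 1)).2 ≤
      ENNReal.ofReal (1 - Real.exp (-1)) * volume (padState D y i).2 := by
  obtain ⟨l, -, -, hv, -, hW⟩ := hD.padState_succ y i
  by_cases h0 : volume (padState D y i).2 = 0
  · rw [h0, mul_zero, hW]
    exact (measure_mono Set.inter_subset_left).trans h0.le
  refine le_trans (measure_mono ?_) (volume_inter_average_le_inner_le (convex_padState_snd D y i)
    (isCompact_padState_snd D y i) h0 (sub_ne_zero.2 hne))
  rw [hW]
  rintro u ⟨hu, hu'⟩
  have hu' : 0 ≤ inner ℝ u _ := hu'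
  refine ⟨hu, show _ ≤ inner ℝ u _ from le_trans ?_ hu'⟩
  rw [← neg_sub, inner_neg_right] at hv
  exact neg_nonneg.1 hv

theorem volume_initial_pos (hD : IsSpannerInstance D K q R α β) :
    0 < volume ((D.cone : Set (Vec d)) ∩ Metric.closedBall 0 1) := by
  have ho : IsOpen ({x : Vec d | ∀ i, 0 < x i} ∩ Metric.ball 0 1) := by
    refine IsOpen.inter ?_ Metric.isOpen_ball
    have : {x : Vec d | ∀ i, 0 < x i} = ⋂ i, {x : Vec d | 0 < x i} := by ext; simp
    rw [this]
    exact isOpen_iInter_of_finite fun i => isOpen_lt continuous_const (by fun_prop)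
  have hne : ({x : Vec d | ∀ i, 0 < x i} ∩ Metric.ball 0 1).Nonempty := by
    have hd : (0 : ℝ) < d + 1 := by positivity
    -- The squared norm of this point is `d / (d + 1)² < 1`.
    refine ⟨WithLp.toLp 2 fun _ => 1 / ((d : ℝ) + 1), fun i => ?_, ?_⟩
    · simpa using hd
    · rw [mem_ball_zero_iff, ← sq_lt_one_iff₀ (norm_nonneg _), EuclideanSpace.norm_sq_eq]
      simp only [Real.norm_eq_abs, sq_abs, Finset.sum_const, Finset.card_univ, Fintype.card_fin,
        nsmul_eq_mul]
      rw [div_pow, one_pow, mul_one_div, div_lt_one (by positivity)]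
      have : (0 : ℝ) ≤ d := Nat.cast_nonneg d
      nlinarith
  refine (ho.measure_pos volume hne).trans_le (measure_mono ?_)
  rintro x ⟨hx, hx1⟩
  exact ⟨hD.orthant_subset fun i => (hx i).le, Metric.ball_subset_closedBall hx1⟩

/-- The left side is `log (1 / δ)` for the contraction ratio `δ` of `not_separated`. The factor `2`
in the loop condition absorbs both `ε ≤ α R` and `R ≤ α R`. -/
theorem log_ratio_le (hD : IsSpannerInstance D K q R α β) {e z : ℝ} (he : D.tol < e) (hz : 0 ≤ z) :
    Real.log ((e + R + z) / e) ≤ Real.log (2 * (D.radius + z) / D.tol) := by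
  have hR := hD.R_pos
  have ht := hD.tol_pos
  have he0 : 0 < e := ht.trans he
  refine Real.log_le_log (by positivity) ?_
  have h1 : (R + z) / e ≤ (R + z) / D.tol := by gcongr
  have h2 : (e + R + z) / e = 1 + (R + z) / e := by field_simp; ring
  have h3 : 1 ≤ α := hD.one_le
  have h4 : R ≤ α * R := by nlinarith
  have h5 := hD.tol_le
  calc (e + R + z) / e ≤ 1 + (R + z) / D.tol := by linarith
    _ = (D.tol + R + z) / D.tol := by field_simp; ring
    _ ≤ 2 * (D.radius + z) / D.tol := by
        rw [hD.radius]
        gcongr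
        linarith

/-- At the end of the loop no direction of the cone separates the current point from all atoms by
more than the tolerance. -/
theorem not_separated (hD : IsSpannerInstance D K q R α β) (y : Vec d) {k : ℕ} (hk0 : 0 < k)
    (hk : 5 * d * Real.log (2 * (D.radius + ‖(padState D y k).1‖) / D.tol) ≤ k)
    {e : ℝ} (he : D.tol < e) {h : Vec d} (hh : h ∈ D.cone) (hh1 : ‖h‖ ≤ 1)
    (hsep : ∀ i < k, e ≤ inner ℝ h (padAtom D y i - (padState D y k).1)) : False := by
  have hR := hD.R_pos
  have he0 : 0 < e := hD.tol_pos.trans he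
  set z := (padState D y k).1 with hz
  set V := volume ((D.cone : Set (Vec d)) ∩ Metric.closedBall 0 1) with hV
  have hV0 : V ≠ 0 := hD.volume_initial_pos.ne'
  have hVt : V ≠ ∞ := (isCompact_padState_snd D y 0).measure_lt_top.ne
  have mono : ∀ u ∈ D.cone, ∀ i < k,
      inner ℝ u (padAtom D y i - z) ≤ inner ℝ u (padAtom D y i - (padState D y (i + 1)).1) := by
    intro u hu i hi
    have := hD.inner_padState_mono hu y (show i + 1 ≤ k from hi)
    simp only at this
    rw [inner_sub_right, inner_sub_right, hz]
    linarith
  have hne : ∀ i < k, padAtom D y i ≠ (padState D y (i + 1)).1 := by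
    intro i hi heq
    have h1 := (hsep i hi).trans (mono h hh i hi)
    rw [heq, sub_self, inner_zero_right] at h1
    linarith
  have hr0 : (0 : ℝ) < 1 - Real.exp (-1) := by
    have := Real.exp_lt_one_iff.2 (show (-1 : ℝ) < 0 by norm_num)
    linarith
  have up : ∀ j ≤ k, volume (padState D y j).2 ≤ ENNReal.ofReal (1 - Real.exp (-1)) ^ j * V := by
    intro j hj
    induction j with
    | zero => simp [padState, hV]
    | succ j ih =>
      refine (hD.volume_padState_succ_le y j (hne j hj)).trans ?_
      rw [pow_succ', mul_assoc]
      gcongr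
      exact ih (by omega)
  -- This ratio balances `(1 - δ) e = δ (R + ‖z‖)`: the margin kept from `h` exactly pays for the
  -- worst direction `u` in the unit ball, so `(1 - δ) h + δ u` satisfies every cut.
  set δ := e / (e + R + ‖z‖) with hδ
  have hden : 0 < e + R + ‖z‖ := by positivity
  have hδ0 : 0 < δ := by positivity
  have hδ1 : δ ≤ 1 := by
    rw [hδ, div_le_one hden]
    have := norm_nonneg z
    linarith
  have low : ENNReal.ofReal (δ ^ d) * V ≤ volume (padState D y k).2 := by
    have := Measure.addHaar_image_homothety volume h δ
      ((D.cone : Set (Vec d)) ∩ Metric.closedBall 0 1)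
    rw [abs_of_nonneg (by positivity), finrank_euclideanSpace_fin] at this
    rw [hV, ← this]
    refine measure_mono ?_
    rintro _ ⟨u, ⟨hu, hu1⟩, rfl⟩
    have hu1' : ‖u‖ ≤ 1 := by simpa using hu1
    have heq : (AffineMap.homothety h δ) u = (1 - δ) • h + δ • u := by
      rw [AffineMap.homothety_apply]
      simp only [vsub_eq_sub, vadd_eq_add]
      module
    rw [heq]
    have hmem : (1 - δ) • h + δ • u ∈ D.cone :=
      add_mem (D.cone.smul_mem hh (by linarith)) (D.cone.smul_mem hu hδ0.le)
    refine hD.mem_padState_snd y hmem ?_ fun i hi => le_trans ?_ (mono _ hmem i hi)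
    · calc ‖(1 - δ) • h + δ • u‖ ≤ ‖(1 - δ) • h‖ + ‖δ • u‖ := norm_add_le _ _
        _ = (1 - δ) * ‖h‖ + δ * ‖u‖ := by
            rw [norm_smul, norm_smul, Real.norm_of_nonneg (by linarith), Real.norm_of_nonneg hδ0.le]
        _ ≤ (1 - δ) * 1 + δ * 1 := by
            have : 0 ≤ 1 - δ := by linarith
            gcongr
        _ = 1 := by ring
    · rw [inner_add_left, inner_smul_left, inner_smul_left, conj_trivial, conj_trivial]
      have h1 : (1 - δ) * e ≤ (1 - δ) * inner ℝ h (padAtom D y i - z) :=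
        mul_le_mul_of_nonneg_left (hsep i hi) (by linarith)
      have h2 : -(R + ‖z‖) ≤ inner ℝ u (padAtom D y i - z) := by
        have h3 := abs_real_inner_le_norm u (padAtom D y i - z)
        have h4 : ‖padAtom D y i - z‖ ≤ R + ‖z‖ :=
          (norm_sub_le _ _).trans (by gcongr; exact hD.norm_le _ (hD.padAtom_mem y i))
        have h5 : ‖u‖ * ‖padAtom D y i - z‖ ≤ 1 * (R + ‖z‖) := by gcongr
        have h6 := neg_abs_le (inner ℝ u (padAtom D y i - z))
        linarith
      have h7 := mul_le_mul_of_nonneg_left h2 hδ0.le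
      have h8 : δ * (e + R + ‖z‖) = e := by rw [hδ]; field_simp
      nlinarith
  have hfin := low.trans (up k le_rfl)
  rw [ENNReal.mul_le_mul_iff_left hV0 hVt, ← ENNReal.ofReal_pow hr0.le,
    ENNReal.ofReal_le_ofReal_iff (by positivity)] at hfin
  have hlog := Real.log_le_log (by positivity) hfin
  rw [Real.log_pow, Real.log_pow] at hlog
  -- Origin of the `5` in the loop condition. The strict inequality and `k > 0` yield the
  -- contradiction.
  have hr : Real.log (1 - Real.exp (-1)) < -(1 / 5) := by
    rw [Real.log_lt_iff_lt_exp hr0]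
    have h1 := Real.add_one_le_exp (-(1 / 5) : ℝ)
    have h2 : (0.3 : ℝ) < Real.exp (-1) := by
      rw [Real.exp_neg, lt_inv_comm₀ (by norm_num) (Real.exp_pos _)]
      exact Real.exp_one_lt_d9.trans (by norm_num)
    linarith
  have hδlog : Real.log δ = -Real.log ((e + R + ‖z‖) / e) := by
    rw [← Real.log_inv, inv_div]
  have h9 := hD.log_ratio_le he (norm_nonneg z)
  have hk' : (0 : ℝ) < k := by exact_mod_cast hk0
  have h10 := mul_lt_mul_of_pos_left hr hk'
  have h11 : (d : ℝ) * Real.log ((e + R + ‖z‖) / e) ≤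
      d * Real.log (2 * (D.radius + ‖z‖) / D.tol) := by gcongr
  rw [hδlog] at hlog
  linarith

end IsSpannerInstance

end PAD

end OnlineBandit

namespace OnlineBandit

/-! ### Quality of the decomposition and length of the loop -/

section PADOutput

variable {d : ℕ} {q : Fin d → Vec d}

open scoped Pointwise in
/-- A convex combination of the atoms plus an element of the dual cone that is nearest to `z`: if no
direction of the cone separates `z` from the atoms by more than `ε`, its distance is at most `ε`. -/
theorem exists_decompositionError_le (C : ProperCone ℝ (Vec d)) {k : ℕ} (hk : 0 < k)
    (v : ℕ → Vec d) (z : Vec d) {ε : ℝ} (hε : 0 ≤ ε)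
    (hsep : ∀ e, ε < e → ∀ h ∈ C, ‖h‖ ≤ 1 → ¬ ∀ i < k, e ≤ inner ℝ h (v i - z)) :
    ∃ p ∈ stdSimplex ℝ (Fin k), ∃ c ∈ ProperCone.innerDual (C : Set (Vec d)),
      decompositionError v z p c ≤ ε ∧
      ∀ p' ∈ stdSimplex ℝ (Fin k), ∀ c' ∈ ProperCone.innerDual (C : Set (Vec d)),
        decompositionError v z p c ≤ decompositionError v z p' c' := by
  set Co := ProperCone.innerDual (C : Set (Vec d)) with hCo
  let A : (Fin k → ℝ) →ₗ[ℝ] Vec d := ∑ i : Fin k, (LinearMap.proj i).smulRight (v i)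
  have hA : ∀ p, A p = ∑ i : Fin k, p i • v i := fun p => by simp [A]
  set S : Set (Vec d) := A '' stdSimplex ℝ (Fin k) + (Co : Set (Vec d)) with hS
  have hAc : IsCompact (A '' stdSimplex ℝ (Fin k)) :=
    (isCompact_stdSimplex ℝ (Fin k)).image (LinearMap.continuous_of_finiteDimensional A)
  -- Compact plus closed is closed, so a nearest point `y` to `z` exists.
  have hScl : IsClosed S := Co.isClosed.add_left_of_isCompact hAc
  have hSconv : Convex ℝ S := ((convex_stdSimplex ℝ (Fin k)).linear_image A).add Co.convex
  have hmem : ∀ p ∈ stdSimplex ℝ (Fin k), ∀ c ∈ Co, A p + c ∈ S := fun p hp c hc =>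
    Set.add_mem_add (Set.mem_image_of_mem A hp) hc
  have hatom : ∀ i (hi : i < k), v i ∈ S := by
    intro i hi
    have h := hmem _ (single_mem_stdSimplex ℝ (⟨i, hi⟩ : Fin k)) 0 (zero_mem _)
    rw [hA, add_zero] at h
    simpa [Pi.single_apply, ite_smul] using h
  obtain ⟨y, hyS, hy⟩ := exists_norm_eq_iInf_of_complete_convex ⟨_, hatom 0 hk⟩
    hScl.isComplete hSconv z
  have hvar := (norm_eq_iInf_iff_real_inner_le_zero hSconv hyS).1 hy
  obtain ⟨_, ⟨p, hp, rfl⟩, c, hc, rfl⟩ := hyS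
  set y := A p + c with hyd
  set g := y - z with hg
  have hvar' : ∀ s ∈ S, 0 ≤ inner ℝ g (s - y) := by
    intro s hs
    have := hvar s hs
    rw [← neg_sub y z, inner_neg_left] at this
    linarith
  have hde : ∀ p' c', decompositionError v z p' c' = ‖A p' + c' - z‖ := fun p' c' => by
    rw [decompositionError, hA]
  have hle : ‖g‖ ≤ ε := by
    by_contra! hlt
    have hg0 : 0 < ‖g‖ := hε.trans_lt hlt
    -- The variational inequality at `y + c'` gives `⟪g, c'⟫ ≥ 0` on the dual cone, so the residual
    -- `g` lies in the bidual of `C`, which is `C`. Normalized, it separates `z` from the atoms by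
    -- `‖g‖`.
    have hgC : g ∈ C := by
      rw [← ProperCone.innerDual_innerDual C, ProperCone.mem_innerDual]
      intro c' hc'
      have h := hvar' (y + c') (by
        rw [hyd, add_assoc]
        exact hmem p hp _ (add_mem hc hc'))
      rwa [add_sub_cancel_left, real_inner_comm] at h
    refine hsep ‖g‖ hlt (‖g‖⁻¹ • g) (C.smul_mem hgC (by positivity)) ?_ fun i hi => ?_
    · rw [norm_smul, norm_inv, norm_norm, inv_mul_cancel₀ hg0.ne']
    · have h1 := hvar' (v i) (hatom i hi)
      have h2 : v i - z = (v i - y) + g := by rw [hg]; abel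
      rw [inner_smul_left, conj_trivial, h2, inner_add_right, real_inner_self_eq_norm_sq,
        mul_add, pow_two, inv_mul_cancel_left₀ hg0.ne']
      have := mul_nonneg (inv_nonneg.2 hg0.le) h1
      linarith
  refine ⟨p, hp, c, hc, (hde p c).trans_le hle, fun p' hp' c' hc' => ?_⟩
  rw [hde, hde, norm_sub_rev, ← hyd, hy, norm_sub_rev]
  exact ciInf_le ⟨0, by rintro _ ⟨w, rfl⟩; exact norm_nonneg _⟩
    (⟨_, hmem p' hp' c' hc'⟩ : S)

/-- The properties of a decomposition that the bandit algorithm uses. -/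
structure IsGoodOutput (D : OMDData d) (K : Set (Vec d)) (out : PADOutput d) : Prop where
  atom_mem : ∀ j, out.atom j ∈ K
  weight_mem : out.weight ∈ stdSimplex ℝ (Fin out.size)
  sum_le : ∀ f ∈ orthant d, ∑ j : Fin out.size, out.weight j * inner ℝ f (out.atom j) ≤
    inner ℝ f out.point + D.tol * ‖f‖

/-- The upper bound for the number of passes through the loop in terms of the squared local distance
`D` of the starting point from `α K`. -/
def callsBound (d : ℕ) (R α ε D : ℝ) : ℝ :=
  1 + 5 * d * Real.log ((4 * α * R + 2 * R * √(d * D)) / ε)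

namespace IsSpannerInstance

variable {D : OMDData d} {K : Set (Vec d)} {R α β : ℝ}

theorem norm_padState_le (hD : IsSpannerInstance D K q R α β) {x : Vec d} (hx : x ∈ K) (y : Vec d)
    (i : ℕ) : ‖(padState D y i).1‖ ≤
      α * R + R * √(d * ‖spannerCoord q (y - α • x)‖ ^ 2) := by
  have h1 := norm_sq_le_mul_norm_spannerCoord_sq hD.linearIndependent
    (fun i => hD.norm_le _ (hD.spanner.mem i)) ((padState D y i).1 - α • x)
  have h2 := hD.norm_spannerCoord_padState_sub_le hx y i
  have hR := hD.R_pos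
  have hα : 0 ≤ α := zero_le_one.trans hD.one_le
  have h3 : ‖(padState D y i).1 - α • x‖ ≤ R * √(d * ‖spannerCoord q (y - α • x)‖ ^ 2) := by
    rw [← abs_of_nonneg (norm_nonneg ((padState D y i).1 - α • x)), ← Real.sqrt_sq hR.le,
      ← Real.sqrt_mul (sq_nonneg R)]
    refine Real.abs_le_sqrt (h1.trans ?_)
    rw [mul_assoc, mul_left_comm]
    gcongr
  have h4 : ‖(padState D y i).1‖ ≤ ‖α • x‖ + ‖(padState D y i).1 - α • x‖ :=
    norm_le_insert' _ _
  have h5 : ‖α • x‖ ≤ α * R := by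
    rw [norm_smul, Real.norm_of_nonneg hα]
    gcongr
    exact hD.norm_le x hx
  linarith

/-- The iterates are bounded, so the threshold of the loop is bounded uniformly in `i` and is
eventually reached. The pass before the exit was still below it, whence the summand `1` in
`callsBound`. -/
theorem exists_padCalls_eq (hD : IsSpannerInstance D K q R α β) (hd : 0 < d) {x : Vec d}
    (hx : x ∈ K) (y : Vec d) :
    ∃ k : ℕ, padCalls D y = k ∧ 0 < k ∧
      5 * d * Real.log (2 * (D.radius + ‖(padState D y k).1‖) / D.tol) ≤ k ∧
      (k : ℝ) ≤ callsBound d R α D.tol (‖spannerCoord q (y - α • x)‖ ^ 2) := by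
  classical
  have hR := hD.R_pos
  have hα : 0 < α := zero_lt_one.trans_le hD.one_le
  have ht := hD.tol_pos
  set b : ℕ → ℝ := fun i =>
    5 * d * Real.log (2 * (D.radius + ‖(padState D y i).1‖) / D.tol) with hb
  have hdp : (0 : ℝ) < d := by exact_mod_cast hd
  have hbB : ∀ i, b i ≤ 5 * d * Real.log ((4 * α * R +
      2 * R * √(d * ‖spannerCoord q (y - α • x)‖ ^ 2)) / D.tol) := by
    intro i
    have := hD.norm_padState_le hx y i
    have h0 := norm_nonneg (padState D y i).1
    simp only [hb, hD.radius]
    gcongr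
    linarith
  have hex : ∃ i : ℕ, b i ≤ i := by
    obtain ⟨n, hn⟩ := exists_nat_ge (5 * d * Real.log ((4 * α * R +
      2 * R * √(d * ‖spannerCoord q (y - α • x)‖ ^ 2)) / D.tol))
    exact ⟨n, (hbB n).trans hn⟩
  -- Since `ε ≤ α R`, the logarithm in the first test is positive: at least one pass is made, and
  -- the simplex of weights is non-empty.
  have hpos : 0 < Nat.find hex := by
    rw [Nat.find_pos]
    push Not
    have h1 : (1 : ℝ) < 2 * (D.radius + ‖(padState D y 0).1‖) / D.tol := by
      rw [lt_div_iff₀ ht, hD.radius]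
      have := norm_nonneg (padState D y 0).1
      have := hD.tol_le
      nlinarith
    have h2 := Real.log_pos h1
    simp only [hb, Nat.cast_zero]
    positivity
  refine ⟨Nat.find hex, le_antisymm ?_ ?_, hpos, Nat.find_spec hex, ?_⟩
  · exact iInf₂_le (Nat.find hex) (not_lt.2 (Nat.find_spec hex))
  · refine le_iInf₂ fun i hi => ?_
    exact_mod_cast Nat.find_min' hex (not_lt.1 hi)
  · have h1 := Nat.find_min hex (Nat.sub_lt hpos one_pos)
    push Not at h1
    rw [Nat.cast_sub (show 1 ≤ Nat.find hex from hpos), Nat.cast_one] at h1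
    have h2 := hbB (Nat.find hex - 1)
    rw [callsBound]
    linarith

/-- Discarding the dual-cone part `c'` of the decomposition only lowers a non-negative loss, because
`ℝ₊ᵈ ⊆ C` gives `⟪f, c'⟫ ≥ 0`; the remaining error costs at most `ε ‖f‖`. -/
theorem isGoodOutput_pad (hD : IsSpannerInstance D K q R α β) [NeZero d] (y : Vec d) :
    IsGoodOutput D K (pad D y) := by
  obtain ⟨k, hk, hk0, hkd, -⟩ := hD.exists_padCalls_eq (Nat.pos_of_neZero d) (hD.spanner.mem 0) y
  obtain ⟨p, hp, c, hc, hle, hmin⟩ := exists_decompositionError_le D.cone hk0 (padAtom D y)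
    (padState D y k).1 hD.tol_pos.le fun e he h hh hh1 hsep =>
      hD.not_separated y hk0 hkd he hh hh1 hsep
  have hpad : pad D y = ⟨(padState D y k).1, k, k, padAtom D y,
      D.pick k (optimalWeights D.cone k (padAtom D y) (padState D y k).1)⟩ := by
    have h : (padCalls D y).toNat = k := by rw [hk]; rfl
    simp only [pad]
    rw [h, hk]
  obtain ⟨hp', c', hc', hmin'⟩ := hD.pick_mem k
    (optimalWeights D.cone k (padAtom D y) (padState D y k).1) ⟨p, hp, c, hc, hmin⟩
  rw [hpad]
  refine ⟨fun j => hD.padAtom_mem y j, hp', fun f hf => ?_⟩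
  simp only
  set p' := D.pick k (optimalWeights D.cone k (padAtom D y) (padState D y k).1)
  have he := (hmin' p hp c hc).trans hle
  rw [decompositionError] at he
  have h1 : ∑ j : Fin k, p' j * inner ℝ f (padAtom D y j) =
      inner ℝ f (∑ j : Fin k, p' j • padAtom D y j) := by
    simp [inner_sum, inner_smul_right]
  have h2 : ∑ j : Fin k, p' j • padAtom D y j = (padState D y k).1 +
      (∑ j : Fin k, p' j • padAtom D y j + c' - (padState D y k).1) - c' := by abel
  have h3 : 0 ≤ inner ℝ f c' := ProperCone.mem_innerDual.1 hc' (hD.orthant_subset hf)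
  have h4 := real_inner_le_norm f (∑ j : Fin k, p' j • padAtom D y j + c' - (padState D y k).1)
  have h5 := mul_le_mul_of_nonneg_left he (norm_nonneg f)
  rw [h1, h2, inner_sub_right, inner_add_right]
  linarith

theorem pad_calls_le (hD : IsSpannerInstance D K q R α β) [NeZero d] {x : Vec d} (hx : x ∈ K)
    (y : Vec d) : ((pad D y).calls : ℝ≥0∞) ≤
      ENNReal.ofReal (callsBound d R α D.tol (‖spannerCoord q (y - α • x)‖ ^ 2)) := by
  obtain ⟨k, hk, -, -, hkb⟩ := hD.exists_padCalls_eq (Nat.pos_of_neZero d) hx y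
  have : (pad D y).calls = k := hk
  rw [this, ENat.toENNReal_coe, ← ENNReal.ofReal_natCast]
  exact ENNReal.ofReal_le_ofReal hkb

theorem norm_spannerCoord_pad_point_le (hD : IsSpannerInstance D K q R α β) {x : Vec d}
    (hx : x ∈ K) (y : Vec d) : ‖spannerCoord q ((pad D y).point - α • x)‖ ^ 2 ≤
      ‖spannerCoord q (y - α • x)‖ ^ 2 :=
  hD.norm_spannerCoord_padState_sub_le hx y _

end IsSpannerInstance

end PADOutput

end OnlineBandit

/-! ### Expectations under finitely supported laws -/

namespace PMF

variable {α β : Type*}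

/-- The expectation of a real function under a law (meant for finitely supported laws). -/
def expect (p : PMF α) (F : α → ℝ) : ℝ := ∑' a, (p a).toReal * F a

theorem expect_eq_sum {p : PMF α} {s : Finset α} (hp : p.support ⊆ s) (F : α → ℝ) :
    p.expect F = ∑ a ∈ s, (p a).toReal * F a := by
  refine tsum_eq_sum fun a ha => ?_
  have : p a = 0 := by
    by_contra h
    exact ha (hp h)
  simp [this]

theorem sum_toReal_eq_one {p : PMF α} {s : Finset α} (hp : p.support ⊆ s) :
    ∑ a ∈ s, (p a).toReal = 1 := by
  have h : ∑' a, p a = ∑ a ∈ s, p a := tsum_eq_sum fun a ha => by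
    by_contra h
    exact ha (hp h)
  rw [← ENNReal.toReal_sum fun a _ => p.apply_ne_top a, ← h, p.tsum_coe, ENNReal.toReal_one]

theorem expect_mono {p : PMF α} (hp : p.support.Finite) {F G : α → ℝ} (h : ∀ a, F a ≤ G a) :
    p.expect F ≤ p.expect G := by
  rw [expect_eq_sum hp.coe_toFinset.ge, expect_eq_sum hp.coe_toFinset.ge]
  exact Finset.sum_le_sum fun a _ => mul_le_mul_of_nonneg_left (h a) ENNReal.toReal_nonneg

theorem expect_add {p : PMF α} (hp : p.support.Finite) (F G : α → ℝ) :
    p.expect (fun a => F a + G a) = p.expect F + p.expect G := by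
  rw [expect_eq_sum hp.coe_toFinset.ge, expect_eq_sum hp.coe_toFinset.ge,
    expect_eq_sum hp.coe_toFinset.ge, ← Finset.sum_add_distrib]
  simp [mul_add]

theorem expect_const_mul {p : PMF α} (c : ℝ) (F : α → ℝ) :
    p.expect (fun a => c * F a) = c * p.expect F := by
  rw [expect, expect, ← tsum_mul_left]
  simp only [mul_left_comm]

theorem expect_const {p : PMF α} (hp : p.support.Finite) (c : ℝ) : p.expect (fun _ => c) = c := by
  rw [expect_eq_sum hp.coe_toFinset.ge, ← Finset.sum_mul, sum_toReal_eq_one hp.coe_toFinset.ge,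
    one_mul]

theorem expect_pure (a : α) (F : α → ℝ) : (PMF.pure a).expect F = F a := by
  rw [expect_eq_sum (s := {a}) (by simp)]
  simp

theorem expect_fintype [Fintype α] (p : PMF α) (F : α → ℝ) :
    p.expect F = ∑ a, (p a).toReal * F a :=
  tsum_fintype _

theorem support_bind_finite {p : PMF α} {g : α → PMF β} (hp : p.support.Finite)
    (hg : ∀ a, (g a).support.Finite) : (p.bind g).support.Finite := by
  rw [support_bind]
  exact hp.biUnion fun a _ => hg a

theorem expect_bind {p : PMF α} {g : α → PMF β} (hp : p.support.Finite)
    (hg : ∀ a, (g a).support.Finite) (F : β → ℝ) :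
    (p.bind g).expect F = p.expect fun a => (g a).expect F := by
  have hs := support_bind_finite hp hg
  have hsub : ∀ a ∈ p.support, (g a).support ⊆ (hs.toFinset : Set β) := by
    intro a ha
    rw [hs.coe_toFinset, support_bind]
    exact Set.subset_biUnion_of_mem (u := fun a => (g a).support) ha
  rw [expect_eq_sum hs.coe_toFinset.ge, expect_eq_sum hp.coe_toFinset.ge]
  have h1 : ∀ b, ((p.bind g) b).toReal = ∑ a ∈ hp.toFinset, (p a).toReal * (g a b).toReal := by
    intro b
    rw [bind_apply, tsum_eq_sum (s := hp.toFinset), ENNReal.toReal_sum]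
    · simp [ENNReal.toReal_mul]
    · exact fun a _ => ENNReal.mul_ne_top (p.apply_ne_top a) ((g a).apply_ne_top b)
    · intro a ha
      have : p a = 0 := by
        by_contra h
        exact ha (hp.mem_toFinset.2 h)
      simp [this]
  simp only [h1, Finset.sum_mul]
  rw [Finset.sum_comm]
  refine Finset.sum_congr rfl fun a ha => ?_
  rw [expect_eq_sum (hsub a (hp.mem_toFinset.1 ha)), Finset.mul_sum]
  simp only [mul_assoc]

theorem support_map_finite {p : PMF α} (hp : p.support.Finite) (f : α → β) :
    (p.map f).support.Finite := by
  rw [support_map]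
  exact hp.image f

theorem expect_map {p : PMF α} (hp : p.support.Finite) (f : α → β) (F : β → ℝ) :
    (p.map f).expect F = p.expect fun a => F (f a) := by
  rw [map, expect_bind hp fun a => by simp]
  simp only [Function.comp_apply, expect_pure]

variable [MeasurableSpace α] [DiscreteMeasurableSpace α]

theorem integrable_of_support_finite {p : PMF α} (hp : p.support.Finite) (F : α → ℝ) :
    Integrable F p.toMeasure := by
  obtain ⟨C, hC⟩ := (hp.image fun a => ‖F a‖).bddAbove
  refine Integrable.of_bound (Measurable.of_discrete (f := F)).aestronglyMeasurable C ?_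
  rw [ae_iff, toMeasure_apply_eq_zero_iff _ (MeasurableSet.of_discrete)]
  refine Set.disjoint_left.2 fun a ha h => h (hC (Set.mem_image_of_mem _ ha))

theorem integral_eq_expect {p : PMF α} (hp : p.support.Finite) (F : α → ℝ) :
    ∫ a, F a ∂p.toMeasure = p.expect F := by
  rw [integral_eq_tsum p F (integrable_of_support_finite hp F)]
  rfl

end PMF

namespace OnlineBandit

/-! ### Laws of the random draws and of the history -/

section Laws

variable {d : ℕ}

theorem indexLaw_eq_bind {k : ℕ} {p : Fin k → ℝ} (hp : p ∈ stdSimplex ℝ (Fin k)) :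
    ∃ P : PMF (Fin k), (∀ j, P j = ENNReal.ofReal (p j)) ∧
      indexLaw p = P.bind fun j => PMF.pure (j : ℕ) := by
  refine ⟨PMF.ofFintype (fun j => ENNReal.ofReal (p j)) (by
    rw [← ENNReal.ofReal_sum_of_nonneg fun j _ => hp.1 j, hp.2, ENNReal.ofReal_one]),
    fun j => PMF.ofFintype_apply _ j, ?_⟩
  rw [indexLaw, dif_pos hp]
  exact PMF.map_id _

theorem support_indexLaw_finite {k : ℕ} (p : Fin k → ℝ) : (indexLaw p).support.Finite := by
  by_cases h : p ∈ stdSimplex ℝ (Fin k)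
  · obtain ⟨P, -, hP⟩ := indexLaw_eq_bind h
    rw [hP]
    exact PMF.support_bind_finite (Set.toFinite _) fun j => by simp
  · rw [indexLaw, dif_neg h]
    simp

theorem expect_indexLaw {k : ℕ} {p : Fin k → ℝ} (hp : p ∈ stdSimplex ℝ (Fin k)) (F : ℕ → ℝ) :
    (indexLaw p).expect F = ∑ j : Fin k, p j * F j := by
  obtain ⟨P, hPp, hP⟩ := indexLaw_eq_bind hp
  rw [hP, PMF.expect_bind (Set.toFinite _) fun j => by simp, PMF.expect_fintype]
  refine Finset.sum_congr rfl fun j _ => ?_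
  rw [hPp, ENNReal.toReal_ofReal (hp.1 j), PMF.expect_pure]

variable [NeZero d]

theorem support_roundLaw_finite (B : BanditData d) (out : PADOutput d) :
    (roundLaw B out).support.Finite := by
  refine PMF.support_bind_finite (Set.toFinite _) fun b => ?_
  cases b
  · exact PMF.support_map_finite (support_indexLaw_finite _) _
  · exact PMF.support_map_finite (Set.toFinite _) _

theorem expect_roundLaw {B : BanditData d} (h0 : 0 ≤ B.explorProb) (h1 : B.explorProb ≤ 1)
    {out : PADOutput d} (hw : out.weight ∈ stdSimplex ℝ (Fin out.size)) (F : Outcome d → ℝ) :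
    (roundLaw B out).expect F = B.explorProb / d * ∑ i, F (.explore i) +
      (1 - B.explorProb) * ∑ j : Fin out.size, out.weight j * F (.exploit j) := by
  have hb : ∀ b : Bool, ((cond b ((PMF.uniformOfFintype (Fin d)).map Outcome.explore)
      ((indexLaw out.weight).map Outcome.exploit)) : PMF (Outcome d)).support.Finite := by
    intro b
    cases b
    · exact PMF.support_map_finite (support_indexLaw_finite _) _
    · exact PMF.support_map_finite (Set.toFinite _) _
  have hmin : min (ENNReal.ofReal B.explorProb) 1 = ENNReal.ofReal B.explorProb :=
    min_eq_left (by simpa using h1)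
  rw [roundLaw, PMF.expect_bind (Set.toFinite _) hb, PMF.expect_fintype, Fintype.sum_bool]
  simp only [PMF.ofFintype_apply, cond_true, cond_false, hmin]
  rw [PMF.expect_map (Set.toFinite _), PMF.expect_map (support_indexLaw_finite _),
    expect_indexLaw hw, PMF.expect_fintype, ENNReal.toReal_ofReal h0, ENNReal.toReal_sub_of_le
    (by simpa using h1) ENNReal.one_ne_top, ENNReal.toReal_one, ENNReal.toReal_ofReal h0]
  simp only [PMF.uniformOfFintype_apply, Fintype.card_fin, ENNReal.toReal_inv,
    ENNReal.toReal_natCast, ← Finset.mul_sum]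
  ring

theorem support_historyLaw_finite (B : BanditData d) (f : Adversary d) (T : ℕ) :
    (historyLaw B f T).support.Finite := by
  induction T with
  | zero => simp [historyLaw]
  | succ T ih => exact PMF.support_bind_finite ih fun h =>
      PMF.support_map_finite (support_roundLaw_finite _ _) _

theorem expect_historyLaw_succ (B : BanditData d) (f : Adversary d) (T : ℕ) (F : History d → ℝ) :
    (historyLaw B f (T + 1)).expect F = (historyLaw B f T).expect fun h =>
      (roundLaw B (currentOutput B f h)).expect fun r => F (r :: h) := by
  rw [historyLaw, PMF.expect_bind (support_historyLaw_finite B f T) fun h =>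
      PMF.support_map_finite (support_roundLaw_finite _ _) _]
  congr 1
  funext h
  rw [PMF.expect_map (support_roundLaw_finite _ _)]

end Laws

end OnlineBandit

namespace OnlineBandit

/-! ### Analysis of the bandit algorithm -/

section Bandit

variable {d : ℕ}

/-- The standing assumptions on the bandit algorithm and its adversary. -/
structure IsBanditInstance (B : BanditData d) (f : Adversary d) (K : Set (Vec d)) (R L α β : ℝ) :
    Prop extends IsSpannerInstance B.toOMDData K B.spanner R α β where
  rate_pos : 0 < B.rate
  explorProb_pos : 0 < B.explorProb
  explorProb_lt_one : B.explorProb < 1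
  L_pos : 0 < L
  loss_nonneg : ∀ h, f h ∈ orthant d
  norm_loss_le : ∀ h, ‖f h‖ ≤ L

/-- The squared local norm of the difference between the current point and `α x`. -/
def localDist (B : BanditData d) (f : Adversary d) (α : ℝ) (x : Vec d) (h : History d) : ℝ :=
  ‖spannerCoord B.spanner ((currentOutput B f h).point - α • x)‖ ^ 2

/-- The squared local norm of the difference between the point reached from the current one by the
mirror step after exploring `i` and `α x`. -/
def exploreDist (B : BanditData d) (f : Adversary d) (α : ℝ) (x : Vec d) (h : History d)
    (i : Fin d) : ℝ :=
  ‖spannerCoord B.spanner ((currentOutput B f h).point -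
    (B.rate * (d / B.explorProb * inner ℝ (B.spanner i) (f h))) • B.spanner i - α • x)‖ ^ 2

theorem inner_nonneg_of_mem_orthant {x y : Vec d} (hx : x ∈ orthant d) (hy : y ∈ orthant d) :
    0 ≤ inner ℝ x y := by
  rw [PiLp.inner_apply]
  refine Finset.sum_nonneg fun i _ => ?_
  simpa using mul_nonneg (hy i) (hx i)

/-- The largest expected increase of the squared local norm in one round. -/
def distIncrement (B : BanditData d) (R L α : ℝ) : ℝ :=
  4 * B.rate * α * L * R + B.rate ^ 2 * d ^ 2 * L ^ 2 * R ^ 2 / B.explorProb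

namespace IsBanditInstance

variable {B : BanditData d} {f : Adversary d} {K : Set (Vec d)} {R L α β : ℝ}

/-- The gradient of `φ` is the injective linear map `Q⁻¹`, so it cancels and the step moves along
`u` itself. -/
theorem mirrorStep_eq (hB : IsBanditInstance B f K R L α β) (x u : Vec d) (c : ℝ) :
    mirrorStep B.toOMDData x (c • applyQinv B.spanner u) = x - (B.rate * c) • u := by
  have key : ∀ y, gradient B.reg y = gradient B.reg x - B.rate • c • applyQinv B.spanner u ↔
      y = x - (B.rate * c) • u := by
    intro y
    have : applyQinv B.spanner x - B.rate • c • applyQinv B.spanner u =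
        applyQinv B.spanner (x - (B.rate * c) • u) := by
      simp only [applyQinv_eq, map_sub, map_smul, mul_smul]
    rw [hB.reg, gradient_barycentricRegularizer, gradient_barycentricRegularizer, this]
    exact (applyQinv_injective hB.linearIndependent).eq_iff
  exact (key _).1 (Classical.epsilon_spec
    (p := fun y => gradient B.reg y = gradient B.reg x - B.rate • c • applyQinv B.spanner u)
    ⟨_, (key _).2 rfl⟩)

theorem initialPoint_eq (hB : IsBanditInstance B f K R L α β) : initialPoint B.toOMDData = 0 := by
  rw [initialPoint, hB.reg]
  exact argminOn_barycentricRegularizer hB.linearIndependent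

theorem isGoodOutput_currentOutput [NeZero d] (hB : IsBanditInstance B f K R L α β)
    (h : History d) : IsGoodOutput B.toOMDData K (currentOutput B f h) := by
  induction h with
  | nil => exact hB.isGoodOutput_pad _
  | cons r h ih =>
    rw [currentOutput]
    split_ifs
    · exact ih
    · exact hB.isGoodOutput_pad _

theorem currentOutput_exploit (h : History d) (j : ℕ) :
    currentOutput B f (.exploit j :: h) = currentOutput B f h := by
  rw [currentOutput]
  exact if_pos rfl

theorem lossEstimate_explore_eq_zero_iff (hB : IsBanditInstance B f K R L α β) (g : Vec d)
    (i : Fin d) : lossEstimate B g (.explore i) = 0 ↔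
      d / B.explorProb * inner ℝ (B.spanner i) g = 0 := by
  have h1 : applyQinv B.spanner (B.spanner i) ≠ 0 := by
    have h0 : applyQinv B.spanner 0 = 0 := by rw [applyQinv_eq, map_zero]
    rw [← h0]
    exact (applyQinv_injective hB.linearIndependent).ne (hB.linearIndependent.ne_zero i)
  rw [lossEstimate, smul_eq_zero, or_iff_left h1]

theorem localDist_exploit (x : Vec d) (h : History d) (j : ℕ) :
    localDist B f α x (.exploit j :: h) = localDist B f α x h := by
  rw [localDist, currentOutput_exploit, localDist]

/-- If the estimate is zero, the mirror step is trivial and the reused output gives equality;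
otherwise the procedure does not increase the distance to `α x`. -/
theorem localDist_explore_le (hB : IsBanditInstance B f K R L α β) {x : Vec d} (hx : x ∈ K)
    (h : History d) (i : Fin d) :
    localDist B f α x (.explore i :: h) ≤ exploreDist B f α x h i := by
  rw [localDist, currentOutput, exploreDist]
  split_ifs with h0
  · rw [(hB.lossEstimate_explore_eq_zero_iff _ i).1 h0]
    simp
  · refine (hB.norm_spannerCoord_pad_point_le hx _).trans ?_
    rw [lossEstimate, hB.mirrorStep_eq]

theorem norm_spannerCoord_initialPoint_sub_le (hB : IsBanditInstance B f K R L α β) {x : Vec d}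
    (hx : x ∈ K) : ‖spannerCoord B.spanner (initialPoint B.toOMDData - α • x)‖ ^ 2 ≤
      α ^ 2 * β ^ 2 * d := by
  have := hB.spanner.norm_spannerCoord_sq_le hx
  rw [hB.initialPoint_eq, zero_sub, map_neg, norm_neg, map_smul, norm_smul, mul_pow,
    Real.norm_eq_abs, sq_abs, mul_assoc]
  gcongr

theorem localDist_nil_le (hB : IsBanditInstance B f K R L α β) {x : Vec d} (hx : x ∈ K) :
    localDist B f α x [] ≤ α ^ 2 * β ^ 2 * d :=
  (hB.norm_spannerCoord_pad_point_le hx _).trans (hB.norm_spannerCoord_initialPoint_sub_le hx)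

theorem exploreDist_eq (hB : IsBanditInstance B f K R L α β) (x : Vec d) (h : History d)
    (i : Fin d) : exploreDist B f α x h i = localDist B f α x h -
      2 * (B.rate * (d / B.explorProb)) * (spannerCoord B.spanner
        ((currentOutput B f h).point - α • x) i * inner ℝ (B.spanner i) (f h)) +
      (B.rate * (d / B.explorProb)) ^ 2 * inner ℝ (B.spanner i) (f h) ^ 2 := by
  rw [exploreDist, localDist, sub_right_comm, map_sub, map_smul,
    spannerCoord_apply_spanner hB.linearIndependent, norm_sub_sq_real, inner_smul_right, norm_smul,
    mul_pow, Real.norm_eq_abs, sq_abs]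
  simp only [EuclideanSpace.inner_single_right, PiLp.norm_single]
  simp
  ring

theorem sum_inner_sq_le (hB : IsBanditInstance B f K R L α β) (h : History d) :
    ∑ i, inner ℝ (B.spanner i) (f h) ^ 2 ≤ d * (L ^ 2 * R ^ 2) := by
  have hL := hB.L_pos.le
  calc ∑ i, inner ℝ (B.spanner i) (f h) ^ 2 ≤ ∑ _i : Fin d, L ^ 2 * R ^ 2 := by
        refine Finset.sum_le_sum fun i _ => ?_
        rw [← sq_abs, ← mul_pow]
        have h1 := abs_real_inner_le_norm (B.spanner i) (f h)
        have h2 := hB.norm_le _ (hB.spanner.mem i)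
        have h3 := hB.norm_loss_le h
        have h4 : ‖B.spanner i‖ * ‖f h‖ ≤ R * L := by
          gcongr
          exact hB.R_pos.le
        gcongr
        linarith
    _ = d * (L ^ 2 * R ^ 2) := by simp

/-- Unbiasedness of the estimate: expanding the squares, the linear terms add up by `∑ᵢ (M⁻¹ y)ᵢ
⟪qᵢ, f⟫ = ⟪f, y⟫`, and the weight `γ / d` cancels the factor `d / γ`. -/
theorem mul_sum_exploreDist_le [NeZero d] (hB : IsBanditInstance B f K R L α β) (x : Vec d)
    (h : History d) : B.explorProb / d * ∑ i, exploreDist B f α x h i ≤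
      B.explorProb * localDist B f α x h -
        2 * B.rate * inner ℝ (f h) ((currentOutput B f h).point - α • x) +
        B.rate ^ 2 * d ^ 2 * L ^ 2 * R ^ 2 / B.explorProb := by
  have hγ := hB.explorProb_pos
  have hd : (0 : ℝ) < d := by exact_mod_cast Nat.pos_of_neZero d
  have h1 : ∑ i, exploreDist B f α x h i = d * localDist B f α x h -
      2 * (B.rate * (d / B.explorProb)) * inner ℝ (f h) ((currentOutput B f h).point - α • x) +
      (B.rate * (d / B.explorProb)) ^ 2 * ∑ i, inner ℝ (B.spanner i) (f h) ^ 2 := by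
    simp only [hB.exploreDist_eq, Finset.sum_add_distrib, Finset.sum_sub_distrib, ← Finset.mul_sum]
    rw [sum_spannerCoord_mul_inner hB.linearIndependent, real_inner_comm]
    simp
  rw [h1]
  have h2 : (B.rate * (d / B.explorProb)) ^ 2 * ∑ i, inner ℝ (B.spanner i) (f h) ^ 2 ≤
      (B.rate * (d / B.explorProb)) ^ 2 * (d * (L ^ 2 * R ^ 2)) := by
    gcongr
    exact hB.sum_inner_sq_le h
  calc _ ≤ B.explorProb / d * (d * localDist B f α x h -
      2 * (B.rate * (d / B.explorProb)) * inner ℝ (f h) ((currentOutput B f h).point - α • x) +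
      (B.rate * (d / B.explorProb)) ^ 2 * (d * (L ^ 2 * R ^ 2))) := by gcongr
    _ = _ := by field_simp

theorem inner_atom_nonneg [NeZero d] (hB : IsBanditInstance B f K R L α β) (h : History d) (j : ℕ) :
    0 ≤ inner ℝ (f h) ((currentOutput B f h).atom j) :=
  inner_nonneg_of_mem_orthant (hB.loss_nonneg h)
    (hB.nonneg ((hB.isGoodOutput_currentOutput h).atom_mem j))

theorem sum_inner_atom_le [NeZero d] (hB : IsBanditInstance B f K R L α β) (h : History d) :
    ∑ j : Fin (currentOutput B f h).size, (currentOutput B f h).weight j *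
      inner ℝ (f h) ((currentOutput B f h).atom j) ≤
        inner ℝ (f h) (currentOutput B f h).point + B.tol * L := by
  refine ((hB.isGoodOutput_currentOutput h).sum_le _ (hB.loss_nonneg h)).trans ?_
  have := mul_le_mul_of_nonneg_left (hB.norm_loss_le h) hB.tol_pos.le
  linarith

theorem sum_inner_atom_nonneg [NeZero d] (hB : IsBanditInstance B f K R L α β) (h : History d) :
    0 ≤ ∑ j : Fin (currentOutput B f h).size, (currentOutput B f h).weight j *
      inner ℝ (f h) ((currentOutput B f h).atom j) :=
  Finset.sum_nonneg fun j _ => mul_nonneg ((hB.isGoodOutput_currentOutput h).weight_mem.1 j)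
    (hB.inner_atom_nonneg h j)

theorem inner_loss_le (hB : IsBanditInstance B f K R L α β) {x : Vec d} (hx : x ∈ K)
    (h : History d) : inner ℝ (f h) x ≤ L * R := by
  have h1 := real_inner_le_norm (f h) x
  have h2 := hB.norm_loss_le h
  have h3 := hB.norm_le x hx
  have h4 : ‖f h‖ * ‖x‖ ≤ L * R := by
    gcongr
    exact hB.L_pos.le
  linarith

/-- The current point may be infeasible, but its loss is at least that of the decomposition minus `ε
L`, so at least `-α R L`. With `⟪f, α x⟫ ≤ α L R` the linear term is at most `4 η α L R`. -/
theorem mul_sum_exploreDist_le_add [NeZero d] (hB : IsBanditInstance B f K R L α β) {x : Vec d}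
    (hx : x ∈ K) (h : History d) : B.explorProb / d * ∑ i, exploreDist B f α x h i ≤
      B.explorProb * localDist B f α x h + distIncrement B R L α := by
  refine (hB.mul_sum_exploreDist_le x h).trans ?_
  have h1 := (hB.sum_inner_atom_nonneg h).trans (hB.sum_inner_atom_le h)
  have h2 := mul_le_mul_of_nonneg_left (hB.inner_loss_le hx h) (zero_le_one.trans hB.one_le)
  have h3 := mul_le_mul_of_nonneg_right hB.tol_le hB.L_pos.le
  have h4 : -(2 * α * L * R) ≤ inner ℝ (f h) ((currentOutput B f h).point - α • x) := by
    rw [inner_sub_right, inner_smul_right]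
    linarith
  have h5 := mul_le_mul_of_nonneg_left h4 hB.rate_pos.le
  rw [distIncrement]
  linarith

theorem expect_roundLaw_currentOutput [NeZero d] (hB : IsBanditInstance B f K R L α β)
    (h : History d) (F : Outcome d → ℝ) :
    (roundLaw B (currentOutput B f h)).expect F = B.explorProb / d * ∑ i, F (.explore i) +
      (1 - B.explorProb) * ∑ j : Fin (currentOutput B f h).size,
        (currentOutput B f h).weight j * F (.exploit j) :=
  expect_roundLaw hB.explorProb_pos.le hB.explorProb_lt_one.le
    (hB.isGoodOutput_currentOutput h).weight_mem F

theorem sum_weight_mul [NeZero d] (hB : IsBanditInstance B f K R L α β) (h : History d) (c : ℝ) :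
    ∑ j : Fin (currentOutput B f h).size, (currentOutput B f h).weight j * c = c := by
  rw [← Finset.sum_mul, (hB.isGoodOutput_currentOutput h).weight_mem.2, one_mul]

theorem expect_localDist_cons_le [NeZero d] (hB : IsBanditInstance B f K R L α β) {x : Vec d}
    (hx : x ∈ K) (h : History d) :
    (roundLaw B (currentOutput B f h)).expect (fun r => localDist B f α x (r :: h)) ≤
      localDist B f α x h -
        2 * B.rate * inner ℝ (f h) ((currentOutput B f h).point - α • x) +
        B.rate ^ 2 * d ^ 2 * L ^ 2 * R ^ 2 / B.explorProb := by
  have hγ := hB.explorProb_pos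
  have h1 : B.explorProb / d * ∑ i, localDist B f α x (.explore i :: h) ≤
      B.explorProb / d * ∑ i, exploreDist B f α x h i := by
    gcongr with i
    exact hB.localDist_explore_le hx h i
  rw [hB.expect_roundLaw_currentOutput]
  simp only [localDist_exploit, hB.sum_weight_mul]
  linarith [hB.mul_sum_exploreDist_le x h]

theorem expect_localDist_le [NeZero d] (hB : IsBanditInstance B f K R L α β) {x : Vec d}
    (hx : x ∈ K) (T : ℕ) : (historyLaw B f T).expect (localDist B f α x) ≤
      α ^ 2 * β ^ 2 * d + T * distIncrement B R L α := by
  induction T with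
  | zero =>
    rw [historyLaw, PMF.expect_pure]
    simpa using hB.localDist_nil_le hx
  | succ T ih =>
    have hγ := hB.explorProb_pos
    have hs := support_historyLaw_finite B f T
    rw [expect_historyLaw_succ]
    have step : ∀ h, (roundLaw B (currentOutput B f h)).expect
        (fun r => localDist B f α x (r :: h)) ≤
          localDist B f α x h + distIncrement B R L α := by
      intro h
      rw [hB.expect_roundLaw_currentOutput]
      simp only [localDist_exploit, hB.sum_weight_mul]
      have h1 : B.explorProb / d * ∑ i, localDist B f α x (.explore i :: h) ≤
          B.explorProb / d * ∑ i, exploreDist B f α x h i := by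
        gcongr with i
        exact hB.localDist_explore_le hx h i
      linarith [hB.mul_sum_exploreDist_le_add hx h]
    refine (PMF.expect_mono hs step).trans ?_
    rw [PMF.expect_add hs, PMF.expect_const hs]
    push_cast
    linarith

/-! ### The regret -/

/-- Exploration costs at most `γ L R`. In the exploitation term the factor `1 - γ` may be dropped,
since the losses of the atoms are non-negative. -/
theorem expect_regretAgainst_cons_le [NeZero d] (hB : IsBanditInstance B f K R L α β) (x : Vec d)
    (h : History d) :
    (roundLaw B (currentOutput B f h)).expect (fun r => regretAgainst B f α x (r :: h)) ≤
      regretAgainst B f α x h + inner ℝ (f h) ((currentOutput B f h).point - α • x) +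
        B.tol * L + B.explorProb * L * R := by
  have hγ := hB.explorProb_pos
  have hγ1 := hB.explorProb_lt_one
  have hd : (0 : ℝ) < d := by exact_mod_cast Nat.pos_of_neZero d
  rw [hB.expect_roundLaw_currentOutput]
  simp only [regretAgainst, playedPoint, mul_add, mul_sub, Finset.sum_add_distrib,
    Finset.sum_sub_distrib, hB.sum_weight_mul]
  have h1 : ∑ i, inner ℝ (f h) (B.spanner i) ≤ ∑ _i : Fin d, L * R :=
    Finset.sum_le_sum fun i _ => hB.inner_loss_le (hB.spanner.mem i) h
  have h2 : B.explorProb / d * ∑ i, inner ℝ (f h) (B.spanner i) ≤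
      B.explorProb / d * ∑ _i : Fin d, L * R := by gcongr
  have h3 := hB.sum_inner_atom_le h
  have h4 := mul_nonneg hγ.le (hB.sum_inner_atom_nonneg h)
  have h5 : ∀ c : ℝ, B.explorProb / d * ∑ _i : Fin d, c = B.explorProb * c := by
    intro c
    simp only [Finset.sum_const, Finset.card_univ, Fintype.card_fin, nsmul_eq_mul]
    field_simp
  rw [h5] at h2
  rw [inner_sub_right, inner_smul_right, h5, h5]
  linarith

theorem expect_regretAgainst_le [NeZero d] (hB : IsBanditInstance B f K R L α β) {x : Vec d}
    (hx : x ∈ K) (T : ℕ) : (historyLaw B f T).expect (regretAgainst B f α x) ≤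
      α ^ 2 * β ^ 2 * d / (2 * B.rate) + T * (B.rate * d ^ 2 * L ^ 2 * R ^ 2 / (2 * B.explorProb) +
        B.tol * L + B.explorProb * L * R) := by
  have hη := hB.rate_pos
  have hγ := hB.explorProb_pos
  set c := B.rate * d ^ 2 * L ^ 2 * R ^ 2 / (2 * B.explorProb) + B.tol * L +
    B.explorProb * L * R with hc
  -- Potential argument: the term `⟪f, z - α x⟫` in the regret cancels against the decrease of the
  -- distance divided by `2 η`.
  have key : (historyLaw B f T).expect (fun h => regretAgainst B f α x h +
      1 / (2 * B.rate) * localDist B f α x h) ≤ α ^ 2 * β ^ 2 * d / (2 * B.rate) + T * c := by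
    induction T with
    | zero =>
      rw [historyLaw, PMF.expect_pure, regretAgainst, zero_add, Nat.cast_zero, zero_mul, add_zero,
        one_div_mul_eq_div]
      gcongr
      exact hB.localDist_nil_le hx
    | succ T ih =>
      have hs := support_historyLaw_finite B f T
      rw [expect_historyLaw_succ]
      have step : ∀ h, (roundLaw B (currentOutput B f h)).expect
          (fun r => regretAgainst B f α x (r :: h) +
            1 / (2 * B.rate) * localDist B f α x (r :: h)) ≤
          (regretAgainst B f α x h + 1 / (2 * B.rate) * localDist B f α x h) + c := by
        intro h
        have hr := support_roundLaw_finite B (currentOutput B f h)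
        rw [PMF.expect_add hr, PMF.expect_const_mul]
        have h1 := hB.expect_regretAgainst_cons_le x h
        have h2 := mul_le_mul_of_nonneg_left (hB.expect_localDist_cons_le hx h)
          (show 0 ≤ 1 / (2 * B.rate) by positivity)
        have h3 : 1 / (2 * B.rate) * (localDist B f α x h -
            2 * B.rate * inner ℝ (f h) ((currentOutput B f h).point - α • x) +
            B.rate ^ 2 * d ^ 2 * L ^ 2 * R ^ 2 / B.explorProb) =
            1 / (2 * B.rate) * localDist B f α x h -
              inner ℝ (f h) ((currentOutput B f h).point - α • x) +
              B.rate * d ^ 2 * L ^ 2 * R ^ 2 / (2 * B.explorProb) := by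
          field_simp
        rw [h3] at h2
        rw [hc]
        linarith
      refine (PMF.expect_mono hs step).trans ?_
      rw [PMF.expect_add hs, PMF.expect_const hs]
      push_cast
      linarith
  refine le_trans (PMF.expect_mono (support_historyLaw_finite B f T) fun h => ?_) key
  have : 0 ≤ localDist B f α x h := sq_nonneg _
  have : 0 ≤ 1 / (2 * B.rate) * localDist B f α x h := by positivity
  linarith

end IsBanditInstance

end Bandit

end OnlineBandit

namespace OnlineBandit

/-! ### The number of oracle calls -/

section Calls

variable {d : ℕ}

/-- The logarithm and the square root are concave and increasing, so the composite lies below its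
tangent at `D₀`. A linear bound survives the recursion over rounds and plays the role of Jensen's
inequality. -/
theorem exists_callsBound_le_tangent {R α ε D₀ : ℝ} (hd : 0 < d) (hR : 0 < R) (hα : 0 < α)
    (hε : 0 < ε) (hD₀ : 0 < D₀) : ∃ s, 0 ≤ s ∧ ∀ D, 0 ≤ D →
      callsBound d R α ε D ≤ callsBound d R α ε D₀ + s * (D - D₀) := by
  have hdp : (0 : ℝ) < d := by exact_mod_cast hd
  set u₀ := √(d * D₀) with hu₀
  have hu₀p : 0 < u₀ := Real.sqrt_pos.2 (by positivity)
  set a := 4 * α * R + 2 * R * u₀ with ha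
  have hap : 0 < a := by positivity
  refine ⟨5 * d * (2 * R / a * (d / (2 * u₀))), by positivity, fun D hD => ?_⟩
  set u := √(d * D) with hu
  have hu0 : 0 ≤ u := Real.sqrt_nonneg _
  have h1 : Real.log ((4 * α * R + 2 * R * u) / ε) - Real.log (a / ε) ≤ 2 * R / a * (u - u₀) := by
    rw [← Real.log_div (by positivity) (by positivity)]
    refine (Real.log_le_sub_one_of_pos (by positivity)).trans (le_of_eq ?_)
    rw [div_div_div_cancel_right₀ hε.ne']
    field_simp
    rw [ha]
    ring
  have h2 : u - u₀ ≤ d / (2 * u₀) * (D - D₀) := by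
    have h3 : u ^ 2 = d * D := Real.sq_sqrt (by positivity)
    have h4 : u₀ ^ 2 = d * D₀ := Real.sq_sqrt (by positivity)
    rw [div_mul_eq_mul_div, le_div_iff₀ (by positivity), mul_sub, ← h3, ← h4]
    nlinarith [sq_nonneg (u - u₀)]
  have h5 := mul_le_mul_of_nonneg_left h2 (show 0 ≤ 2 * R / a by positivity)
  have h6 := mul_le_mul_of_nonneg_left (h1.trans h5) (show 0 ≤ 5 * (d : ℝ) by positivity)
  rw [callsBound, callsBound]
  linarith

/-- An upper bound for the number of oracle calls made in the rounds of the history and in the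
round that follows it. -/
def callsUpper (B : BanditData d) (f : Adversary d) (R α : ℝ) (x : Vec d) : History d → ℝ
  | [] => callsBound d R α B.tol
      (‖spannerCoord B.spanner (initialPoint B.toOMDData - α • x)‖ ^ 2)
  | .explore i :: h => callsUpper B f R α x h + callsBound d R α B.tol (exploreDist B f α x h i)
  | .exploit _ :: h => callsUpper B f R α x h

namespace IsBanditInstance

variable {B : BanditData d} {f : Adversary d} {K : Set (Vec d)} {R L α β : ℝ}

theorem callsBound_nonneg (hB : IsBanditInstance B f K R L α β) (D : ℝ) :
    0 ≤ callsBound d R α B.tol D := by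
  have hR := hB.R_pos
  have hα := hB.one_le
  have h1 : 1 ≤ (4 * α * R + 2 * R * √(d * D)) / B.tol := by
    rw [one_le_div hB.tol_pos]
    have := hB.tol_le
    have h3 : 0 ≤ 2 * R * √(d * D) := by positivity
    have h4 : 0 ≤ α * R := by positivity
    linarith
  have := Real.log_nonneg h1
  rw [callsBound]
  positivity

theorem callsUpper_nonneg (hB : IsBanditInstance B f K R L α β) (x : Vec d) (h : History d) :
    0 ≤ callsUpper B f R α x h := by
  induction h with
  | nil => exact hB.callsBound_nonneg _
  | cons r h ih =>
    cases r with
    | explore i => exact add_nonneg ih (hB.callsBound_nonneg _)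
    | exploit j => exact ih

theorem roundCalls_explore_le [NeZero d] (hB : IsBanditInstance B f K R L α β) {x : Vec d}
    (hx : x ∈ K) (h : History d) (i : Fin d) :
    (roundCalls B f (.explore i :: h) : ℝ≥0∞) ≤
      ENNReal.ofReal (callsBound d R α B.tol (exploreDist B f α x h i)) := by
  rw [roundCalls]
  split_ifs with h0
  · simp
  · rw [currentOutput]
    simp only [h0, if_false]
    refine (hB.pad_calls_le hx _).trans (le_of_eq ?_)
    rw [lossEstimate, hB.mirrorStep_eq, exploreDist]

theorem totalCalls_add_roundCalls_le [NeZero d] (hB : IsBanditInstance B f K R L α β) {x : Vec d}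
    (hx : x ∈ K) (h : History d) : ((totalCalls B f h + roundCalls B f h : ℕ∞) : ℝ≥0∞) ≤
      ENNReal.ofReal (callsUpper B f R α x h) := by
  induction h with
  | nil =>
    rw [totalCalls, zero_add]
    exact hB.pad_calls_le hx _
  | cons r h ih =>
    rw [totalCalls, ENat.toENNReal_add]
    cases r with
    | explore i =>
      rw [callsUpper, ENNReal.ofReal_add (hB.callsUpper_nonneg x h) (hB.callsBound_nonneg _)]
      exact add_le_add ih (hB.roundCalls_explore_le hx h i)
    | exploit j =>
      have : roundCalls B f (.exploit j :: h) = 0 := if_pos rfl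
      rw [this, ENat.toENNReal_zero, add_zero]
      exact ih

/-- The calls of a round are made before its outcome is drawn, so the last outcome is irrelevant. -/
theorem totalCalls_le_callsUpper_tail [NeZero d] (hB : IsBanditInstance B f K R L α β) {x : Vec d}
    (hx : x ∈ K) (h : History d) : (totalCalls B f h : ℝ≥0∞) ≤
      ENNReal.ofReal (callsUpper B f R α x h.tail) := by
  cases h with
  | nil => simp [totalCalls]
  | cons r h => exact hB.totalCalls_add_roundCalls_le hx h

/-- After linearization one more round adds at most `γ (g₀ - s D₀) + s (γ D + Y)`, and the
expectation of `D` after `t` rounds is at most `α² β² d + t Y`; the sum of `γ t` over `t < n` is `γ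
n (n - 1) / 2`. -/
theorem expect_callsUpper_le [NeZero d] (hB : IsBanditInstance B f K R L α β) {x : Vec d}
    (hx : x ∈ K) {s D₀ : ℝ} (hs : 0 ≤ s) (hst : ∀ D, 0 ≤ D →
      callsBound d R α B.tol D ≤ callsBound d R α B.tol D₀ + s * (D - D₀)) (n : ℕ) :
    (historyLaw B f n).expect (callsUpper B f R α x) ≤
      (1 + B.explorProb * n) * (callsBound d R α B.tol D₀ + s * (α ^ 2 * β ^ 2 * d - D₀)) +
        s * ((B.explorProb * (n * (n - 1) / 2) + n) * distIncrement B R L α) := by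
  have hγ := hB.explorProb_pos
  have hd : (0 : ℝ) < d := by exact_mod_cast Nat.pos_of_neZero d
  set Y := distIncrement B R L α
  set g₀ := callsBound d R α B.tol D₀
  induction n with
  | zero =>
    rw [historyLaw, PMF.expect_pure, callsUpper]
    refine (hst _ (sq_nonneg _)).trans ?_
    have := mul_le_mul_of_nonneg_left (hB.norm_spannerCoord_initialPoint_sub_le hx) hs
    simp only [Nat.cast_zero]
    linarith
  | succ n ih =>
    have hfin := support_historyLaw_finite B f n
    rw [expect_historyLaw_succ]
    have step : ∀ h, (roundLaw B (currentOutput B f h)).expect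
        (fun r => callsUpper B f R α x (r :: h)) ≤ callsUpper B f R α x h +
          (s * B.explorProb * localDist B f α x h + (B.explorProb * (g₀ - s * D₀) + s * Y)) := by
      intro h
      rw [hB.expect_roundLaw_currentOutput]
      simp only [callsUpper, hB.sum_weight_mul, Finset.sum_add_distrib, mul_add]
      have h1 : B.explorProb / d * ∑ i, callsBound d R α B.tol (exploreDist B f α x h i) ≤
          B.explorProb / d * ∑ i, (s * exploreDist B f α x h i + (g₀ - s * D₀)) := by
        gcongr with i
        linarith [hst (exploreDist B f α x h i) (sq_nonneg _)]
      rw [Finset.sum_add_distrib, ← Finset.mul_sum] at h1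
      have h2 : ∀ c : ℝ, B.explorProb / d * ∑ _i : Fin d, c = B.explorProb * c := by
        intro c
        simp only [Finset.sum_const, Finset.card_univ, Fintype.card_fin, nsmul_eq_mul]
        field_simp
      rw [mul_add, h2] at h1
      rw [h2]
      have h3 := mul_le_mul_of_nonneg_left (hB.mul_sum_exploreDist_le_add hx h) hs
      linarith
    refine (PMF.expect_mono hfin step).trans ?_
    rw [PMF.expect_add hfin, PMF.expect_add hfin, PMF.expect_const hfin, PMF.expect_const_mul]
    have h4 := mul_le_mul_of_nonneg_left (hB.expect_localDist_le hx n)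
      (show 0 ≤ s * B.explorProb by positivity)
    push_cast
    linarith

theorem distIncrement_nonneg (hB : IsBanditInstance B f K R L α β) :
    0 ≤ distIncrement B R L α := by
  have := hB.R_pos
  have := hB.L_pos
  have := hB.rate_pos
  have := hB.explorProb_pos
  have := zero_lt_one.trans_le hB.one_le
  rw [distIncrement]
  positivity

theorem lintegral_totalCalls_le [NeZero d] (hB : IsBanditInstance B f K R L α β) (hβ : 0 < β)
    {T : ℕ} (hT : 1 ≤ T) :
    ∫⁻ h, (totalCalls B f h : ℝ≥0∞) ∂(historyLaw B f T).toMeasure ≤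
      ENNReal.ofReal ((1 + B.explorProb * T) * callsBound d R α B.tol
        (α ^ 2 * β ^ 2 * d + B.rate ^ 2 * L ^ 2 * R ^ 2 * d ^ 2 / B.explorProb * T +
          6 * B.rate * α * L * R * T)) := by
  have hR := hB.R_pos
  have hL := hB.L_pos
  have hη := hB.rate_pos
  have hγ := hB.explorProb_pos
  have hα := zero_lt_one.trans_le hB.one_le
  have hdn := Nat.pos_of_neZero d
  have hd : (0 : ℝ) < d := by exact_mod_cast hdn
  have hx := hB.spanner.mem 0
  set x := B.spanner 0
  obtain ⟨n, rfl⟩ : ∃ n, T = n + 1 := ⟨T - 1, by omega⟩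
  set D₀ := α ^ 2 * β ^ 2 * d + B.rate ^ 2 * L ^ 2 * R ^ 2 * d ^ 2 / B.explorProb * (n + 1 : ℕ) +
    6 * B.rate * α * L * R * (n + 1 : ℕ) with hD₀
  have hD₀p : 0 < D₀ := by positivity
  obtain ⟨s, hs, hst⟩ := exists_callsBound_le_tangent (ε := B.tol) hdn hR hα hB.tol_pos hD₀p
  have hfin := support_historyLaw_finite B f (n + 1)
  refine (lintegral_mono fun h => hB.totalCalls_le_callsUpper_tail hx h).trans ?_
  rw [← ofReal_integral_eq_lintegral_ofReal (PMF.integrable_of_support_finite hfin _)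
    (Filter.Eventually.of_forall fun h => hB.callsUpper_nonneg x h.tail),
    PMF.integral_eq_expect hfin, expect_historyLaw_succ]
  refine ENNReal.ofReal_le_ofReal ?_
  simp only [List.tail_cons, PMF.expect_const (support_roundLaw_finite _ _)]
  refine (hB.expect_callsUpper_le hx hs hst n).trans ?_
  set Y := distIncrement B R L α with hY
  have hY0 : 0 ≤ Y := hB.distIncrement_nonneg
  have hg := hB.callsBound_nonneg D₀
  have hn : (0 : ℝ) ≤ n := Nat.cast_nonneg n
  -- The tangent point `D₀` dominates the bound on the expected distance after `T = n + 1` rounds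
  -- (`6 η` against the `4 η` in `Y`), so all terms carrying the slope `s` add up to at most zero.
  have h1 : α ^ 2 * β ^ 2 * d - D₀ ≤ -((n + 1) * Y) := by
    have h2 : 0 ≤ 2 * B.rate * α * L * R * (n + 1) := by positivity
    rw [hD₀, hY, distIncrement]
    push_cast
    ring_nf at h2 ⊢
    linarith
  have h3 : (1 + B.explorProb * n) * (α ^ 2 * β ^ 2 * d - D₀) +
      (B.explorProb * (n * (n - 1) / 2) + n) * Y ≤ 0 := by
    have h4 := mul_le_mul_of_nonneg_left h1 (show 0 ≤ 1 + B.explorProb * n by positivity)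
    have h5 : 0 ≤ (1 + B.explorProb * (n * (n + 3) / 2)) * Y := by positivity
    linarith
  have h6 := mul_le_mul_of_nonneg_left h3 hs
  have h7 : 0 ≤ B.explorProb * callsBound d R α B.tol D₀ := by positivity
  push_cast
  linarith

end IsBanditInstance

end Calls

/-! ### The choice of the parameters -/

theorem rpow_div_three {x : ℝ} (hx : 0 ≤ x) (n : ℕ)
    : x ^ ((n : ℝ) / 3) = (x ^ (1 / 3 : ℝ)) ^ n := by
  rw [← Real.rpow_natCast, ← Real.rpow_mul hx]
  congr 1
  ring

/-- With `b = β^(1/3)` and `t = T^(1/3)` this is a rational identity. In units of `α L R d b² t²`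
the first three terms are `1/2`, `1/2` and `2`; the last term is `α L R`. -/
theorem regret_bound_eq {d α β η ε γ L R T : ℝ} (hα : 0 < α) (hβ : 0 < β)
    (hL : 0 < L) (hR : 0 < R) (hT : 0 < T)
    (hη : η = α * β ^ (4 / 3 : ℝ) / (L * R * T ^ (2 / 3 : ℝ))) (hε : ε = α * R / T)
    (hγ : γ = β ^ (2 / 3 : ℝ) * d / T ^ (1 / 3 : ℝ)) :
    α ^ 2 * β ^ 2 * d / (2 * η) + η * L ^ 2 * R ^ 2 * d ^ 2 / (2 * γ) * T
      + 2 * γ * α * L * R * T + ε * L * T = α * L * R * (3 * d * (β * T) ^ (2 / 3 : ℝ) + 1) := by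
  have e4 := rpow_div_three hβ.le 4
  have e2 := rpow_div_three hβ.le 2
  have t2 := rpow_div_three hT.le 2
  have hb3 : β = (β ^ (1 / 3 : ℝ)) ^ 3 := by
    rw [← rpow_div_three hβ.le 3]; norm_num
  have ht3 : T = (T ^ (1 / 3 : ℝ)) ^ 3 := by
    rw [← rpow_div_three hT.le 3]; norm_num
  push_cast at e4 e2 t2
  rw [Real.mul_rpow hβ.le hT.le]
  rw [e2, t2, hη, hε, hγ, e4, e2, t2]
  have hbp : 0 < β ^ (1 / 3 : ℝ) := Real.rpow_pos_of_pos hβ _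
  have htp : 0 < T ^ (1 / 3 : ℝ) := Real.rpow_pos_of_pos hT _
  generalize β ^ (1 / 3 : ℝ) = b at *
  generalize T ^ (1 / 3 : ℝ) = t at *
  subst hb3 ht3
  field_simp
  ring

theorem explorProb_lt_one_of_lt {d β T : ℝ} (hβ : 0 < β) (hT : 0 < T)
    (h : β ^ 2 * d ^ 3 < T) : β ^ (2 / 3 : ℝ) * d < T ^ (1 / 3 : ℝ) := by
  have e2 := rpow_div_three hβ.le 2
  push_cast at e2
  rw [e2]
  have hb3 : β = (β ^ (1 / 3 : ℝ)) ^ 3 := by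
    rw [← rpow_div_three hβ.le 3]; norm_num
  have ht3 : T = (T ^ (1 / 3 : ℝ)) ^ 3 := by
    rw [← rpow_div_three hT.le 3]; norm_num
  have hbp : 0 < β ^ (1 / 3 : ℝ) := Real.rpow_pos_of_pos hβ _
  have htp : 0 < T ^ (1 / 3 : ℝ) := Real.rpow_pos_of_pos hT _
  generalize β ^ (1 / 3 : ℝ) = b at *
  generalize T ^ (1 / 3 : ℝ) = t at *
  subst hb3 ht3
  refine lt_of_pow_lt_pow_left₀ 3 htp.le (lt_of_eq_of_lt ?_ h)
  ring

theorem calls_bound_le {d α β η ε γ L R T : ℝ} (hd : 1 ≤ d) (hα : 0 < α) (hβ : 1 ≤ β)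
    (hL : 0 < L) (hR : 0 < R) (hT : 2 ≤ T) (hβT : β ^ 2 * d ^ 3 < T)
    (hη : η = α * β ^ (4 / 3 : ℝ) / (L * R * T ^ (2 / 3 : ℝ))) (hε : ε = α * R / T)
    (hγ : γ = β ^ (2 / 3 : ℝ) * d / T ^ (1 / 3 : ℝ)) :
    (1 + γ * T) * (1 + 5 * d * Real.log ((4 * α * R + 2 * R * √(α ^ 2 * β ^ 2 * d ^ 2
      + η ^ 2 * L ^ 2 * R ^ 2 * d ^ 3 / γ * T + 6 * η * α * L * R * d * T)) / ε)) ≤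
      64 * (d ^ 2 * (β * T) ^ (2 / 3 : ℝ) * Real.log T) := by
  have hd0 : 0 < d := by linarith
  have hβ0 : 0 < β := by linarith
  have hT0 : 0 < T := by linarith
  have hlt := explorProb_lt_one_of_lt hβ0 hT0 hβT
  have hlog2 : 1 ≤ 2 * Real.log T := by
    have h1 := Real.log_two_gt_d9
    have h2 := Real.log_le_log (by norm_num) hT
    linarith
  have hlogT : 0 < Real.log T := by linarith
  have e4 := rpow_div_three hβ0.le 4
  have e2 := rpow_div_three hβ0.le 2
  have t2 := rpow_div_three hT0.le 2
  have hb3 : β = (β ^ (1 / 3 : ℝ)) ^ 3 := by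
    rw [← rpow_div_three hβ0.le 3]; norm_num
  have ht3 : T = (T ^ (1 / 3 : ℝ)) ^ 3 := by
    rw [← rpow_div_three hT0.le 3]; norm_num
  push_cast at e4 e2 t2
  rw [e2] at hlt
  rw [Real.mul_rpow hβ0.le hT0.le, e2, t2]
  rw [e4, t2] at hη
  rw [e2] at hγ
  have hb1 : 1 ≤ β ^ (1 / 3 : ℝ) := Real.one_le_rpow hβ (by norm_num)
  have ht1 : 1 ≤ T ^ (1 / 3 : ℝ) := Real.one_le_rpow (by linarith) (by norm_num)
  generalize β ^ (1 / 3 : ℝ) = b at *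
  generalize T ^ (1 / 3 : ℝ) = t at *
  have hb0 : 0 < b := by linarith
  have ht0 : 0 < t := by linarith
  have hbt : b ^ 2 ≤ t := by nlinarith [sq_nonneg b]
  have hγT : γ * T = b ^ 2 * d * t ^ 2 := by
    rw [hγ, ht3]; field_simp
  -- The first two summands both equal `α² b² (b² d)²`, the third is `6 α² b² (b² d) t`. From `b² ≤
  -- t` and `b² d < t` the sum is at most `8 α² T ≤ 9 α² T²`.
  have hsqrt : √(α ^ 2 * β ^ 2 * d ^ 2 + η ^ 2 * L ^ 2 * R ^ 2 * d ^ 3 / γ * T +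
      6 * η * α * L * R * d * T) ≤ 3 * α * T := by
    refine Real.sqrt_le_iff.2 ⟨by positivity, ?_⟩
    have h1 : α ^ 2 * β ^ 2 * d ^ 2 + η ^ 2 * L ^ 2 * R ^ 2 * d ^ 3 / γ * T +
        6 * η * α * L * R * d * T = α ^ 2 * (2 * (b ^ 2 * (b ^ 2 * d) ^ 2) +
          6 * (b ^ 2 * (b ^ 2 * d) * t)) := by
      rw [hη, hγ, hb3, ht3]
      field_simp
      ring
    have h2 : b ^ 2 * (b ^ 2 * d) ^ 2 ≤ t * t ^ 2 := by gcongr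
    have h3 : b ^ 2 * (b ^ 2 * d) * t ≤ t * t * t := by gcongr
    have h4 : t * t ^ 2 = T := by rw [ht3]; ring
    have h5 : t * t * t = T := by rw [ht3]; ring
    rw [h4] at h2
    rw [h5] at h3
    rw [h1]
    calc α ^ 2 * (2 * (b ^ 2 * (b ^ 2 * d) ^ 2) + 6 * (b ^ 2 * (b ^ 2 * d) * t))
        ≤ α ^ 2 * (2 * T + 6 * T) := by gcongr
      _ ≤ α ^ 2 * (9 * T ^ 2) := by
          gcongr
          nlinarith
      _ = (3 * α * T) ^ 2 := by ring
  have hε0 : 0 < ε := by rw [hε]; positivity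
  -- The argument is at most `T (4 + 6 T)`, hence at most `T ^ 6` as `T ≥ 2`.
  have hlog : Real.log ((4 * α * R + 2 * R * √(α ^ 2 * β ^ 2 * d ^ 2 +
      η ^ 2 * L ^ 2 * R ^ 2 * d ^ 3 / γ * T + 6 * η * α * L * R * d * T)) / ε) ≤
      6 * Real.log T := by
    have h6 : 6 * Real.log T = Real.log (T ^ 6) := by rw [Real.log_pow]; norm_num
    rw [h6]
    refine Real.log_le_log (by positivity) ?_
    rw [div_le_iff₀ hε0]
    have h7 : (16 : ℝ) ≤ T ^ 4 := by
      calc (16 : ℝ) = 2 ^ 4 := by norm_num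
        _ ≤ T ^ 4 := by gcongr
    have h8 : T ^ 6 * ε = α * R * (T * T ^ 4) := by rw [hε]; field_simp
    have h9 : T * 16 ≤ T * T ^ 4 := by gcongr
    have h10 : α * R * (4 + 6 * T) ≤ α * R * (T * T ^ 4) := by
      gcongr
      linarith
    have h11 := mul_le_mul_of_nonneg_left hsqrt (show 0 ≤ 2 * R by positivity)
    rw [h8]
    linarith
  have hone : 1 ≤ b ^ 2 * d * t ^ 2 := by
    have h12 : 1 ≤ b ^ 2 := one_le_pow₀ hb1
    have h13 : 1 ≤ t ^ 2 := one_le_pow₀ ht1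
    exact one_le_mul_of_one_le_of_one_le (one_le_mul_of_one_le_of_one_le h12 hd) h13
  rw [hγT]
  -- The constant `64` is `2 * 32`: `1 + γ T ≤ 2 γ T` by `1 ≤ γ T`, and `1 + 30 d log T ≤ 32 d log
  -- T` by `1 ≤ 2 log T`.
  calc _ ≤ (2 * (b ^ 2 * d * t ^ 2)) * (32 * (d * Real.log T)) := by
        have h14 : 5 * d * Real.log ((4 * α * R + 2 * R * √(α ^ 2 * β ^ 2 * d ^ 2 +
            η ^ 2 * L ^ 2 * R ^ 2 * d ^ 3 / γ * T + 6 * η * α * L * R * d * T)) / ε) ≤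
            5 * d * (6 * Real.log T) := by gcongr
        have h15 : 1 * (2 * Real.log T) ≤ d * (2 * Real.log T) := by gcongr
        refine mul_le_mul_of_nonneg (by linarith) (by linarith) (by positivity) (by positivity)
    _ = _ := by ring

end OnlineBandit

end

/-! ### The main theorem -/

theorem OnlineBandit.isBanditInstance_banditAlgorithm {d : ℕ} {K : Set (Vec d)} {R L α β : ℝ}
    (hK0 : K ⊆ orthant d) (hR : 0 < R) (hKR : K ⊆ Metric.closedBall 0 R) (hL : 0 < L)
    (hα : 1 ≤ α) {q : Fin d → Vec d} (hq : IsBarycentricSpanner β q K)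
    {C : ProperCone ℝ (Vec d)} (hC0 : orthant d ⊆ C) (hC1 : (C : Set (Vec d)) ⊆ spannerCone q)
    {oracle : Vec d → Vec d} (hoK : ∀ w ∈ C, oracle w ∈ K)
    (ho : ∀ w ∈ C, ∀ x ∈ K, inner ℝ w (oracle w) ≤ α * inner ℝ w x)
    {pick : (k : ℕ) → Set (Fin k → ℝ) → (Fin k → ℝ)}
    (hpick : ∀ (k : ℕ) (S : Set (Fin k → ℝ)), S.Nonempty → pick k S ∈ S)
    {f : Adversary d} (hf0 : ∀ h, f h ∈ orthant d) (hfL : ∀ h, ‖f h‖ ≤ L)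
    {η ε γ : ℝ} (hη : 0 < η) (hε : 0 < ε) (hεR : ε ≤ α * R) (hγ : 0 < γ) (hγ1 : γ < 1) :
    IsBanditInstance (banditAlgorithm oracle C pick q α R η ε γ) f K R L α β where
  reg := rfl
  radius := rfl
  tol_pos := hε
  tol_le := hεR
  nonneg := hK0
  R_pos := hR
  norm_le x hx := by simpa using hKR hx
  one_le := hα
  spanner := hq
  orthant_subset := hC0
  cone_subset := hC1
  oracle_mem := hoK
  oracle_le := ho
  pick_mem := hpick
  rate_pos := hη
  explorProb_pos := hγ
  explorProb_lt_one := hγ1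
  L_pos := hL
  loss_nonneg := hf0
  norm_loss_le := hfL

theorem mainTheorem6 :
    ∃ c : ℝ, 0 < c ∧
      ∀ (d : ℕ) [NeZero d] (K : Set (Vec d)) (R L α β : ℝ)
        (_hK : IsCompact K) (_hK0 : K ⊆ orthant d) (_hR : 0 < R)
        (_hKR : K ⊆ Metric.closedBall 0 R) (_hL : 0 < L) (_hα : 1 ≤ α) (_hβ : 0 < β)
        (q : Fin d → Vec d) (_hq : IsBarycentricSpanner β q K)
        (C : ProperCone ℝ (Vec d)) (_hC0 : orthant d ⊆ C) (_hC1 : (C : Set (Vec d)) ⊆ spannerCone q)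
        (oracle : Vec d → Vec d)
        (_hoK : ∀ w ∈ C, oracle w ∈ K)
        (_ho : ∀ w ∈ C, ∀ x ∈ K, inner ℝ w (oracle w) ≤ α * inner ℝ w x)
        (pick : (k : ℕ) → Set (Fin k → ℝ) → (Fin k → ℝ))
        (_hpick : ∀ (k : ℕ) (S : Set (Fin k → ℝ)), S.Nonempty → pick k S ∈ S)
        (f : Adversary d) (_hf0 : ∀ h, f h ∈ orthant d) (_hfL : ∀ h, ‖f h‖ ≤ L)
        (T : ℕ) (_hT : 1 ≤ T),
        (∀ η ε γ : ℝ, 0 < η → 0 < ε → ε ≤ α * R → 0 < γ → γ < 1 →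
          let B := banditAlgorithm oracle C pick q α R η ε γ
          (∀ x ∈ K,
            Integrable (regretAgainst B f α x) (historyLaw B f T).toMeasure ∧
            ∫ h, regretAgainst B f α x h ∂(historyLaw B f T).toMeasure ≤
              α ^ 2 * β ^ 2 * d / (2 * η) + η * L ^ 2 * R ^ 2 * d ^ 2 / (2 * γ) * T
                + 2 * γ * α * L * R * T + ε * L * T) ∧
          ∫⁻ h, (totalCalls B f h : ℝ≥0∞) ∂(historyLaw B f T).toMeasure ≤
            ENNReal.ofReal ((1 + γ * T) * (1 + 5 * d * Real.log
              ((4 * α * R + 2 * R * √(α ^ 2 * β ^ 2 * d ^ 2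
                + η ^ 2 * L ^ 2 * R ^ 2 * d ^ 3 / γ * T + 6 * η * α * L * R * d * T)) / ε)))) ∧
        (β ^ 2 * (d : ℝ) ^ 3 < T →
          let η : ℝ := α * β ^ (4 / 3 : ℝ) / (L * R * (T : ℝ) ^ (2 / 3 : ℝ))
          let ε : ℝ := α * R / T
          let γ : ℝ := β ^ (2 / 3 : ℝ) * d / (T : ℝ) ^ (1 / 3 : ℝ)
          let B := banditAlgorithm oracle C pick q α R η ε γ
          (∀ x ∈ K,
            Integrable (regretAgainst B f α x) (historyLaw B f T).toMeasure ∧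
            ∫ h, regretAgainst B f α x h ∂(historyLaw B f T).toMeasure ≤
              α * L * R * (3 * d * (β * T) ^ (2 / 3 : ℝ) + 1)) ∧
          ∫⁻ h, (totalCalls B f h : ℝ≥0∞) ∂(historyLaw B f T).toMeasure ≤
            ENNReal.ofReal (c * (d ^ 2 * (β * T) ^ (2 / 3 : ℝ) * Real.log T))) := by
  refine ⟨64, by norm_num, ?_⟩
  intro d _ K R L α β _ hK0 hR hKR hL hα hβ q hq C hC0 hC1 oracle hoK ho pick hpick f hf0 hfL T hT
  have hα0 : 0 < α := zero_lt_one.trans_le hα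
  have hT0 : (0 : ℝ) < T := by exact_mod_cast hT
  have general : ∀ η ε γ : ℝ, 0 < η → 0 < ε → ε ≤ α * R → 0 < γ → γ < 1 →
      let B := banditAlgorithm oracle C pick q α R η ε γ
      (∀ x ∈ K,
        Integrable (regretAgainst B f α x) (historyLaw B f T).toMeasure ∧
        ∫ h, regretAgainst B f α x h ∂(historyLaw B f T).toMeasure ≤
          α ^ 2 * β ^ 2 * d / (2 * η) + η * L ^ 2 * R ^ 2 * d ^ 2 / (2 * γ) * T
            + 2 * γ * α * L * R * T + ε * L * T) ∧
      ∫⁻ h, (totalCalls B f h : ℝ≥0∞) ∂(historyLaw B f T).toMeasure ≤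
        ENNReal.ofReal ((1 + γ * T) * (1 + 5 * d * Real.log
          ((4 * α * R + 2 * R * √(α ^ 2 * β ^ 2 * d ^ 2
            + η ^ 2 * L ^ 2 * R ^ 2 * d ^ 3 / γ * T + 6 * η * α * L * R * d * T)) / ε))) := by
    intro η ε γ hη hε hεR hγ hγ1 B
    have hB : IsBanditInstance B f K R L α β := isBanditInstance_banditAlgorithm hK0 hR hKR hL hα hq
      hC0 hC1 hoK ho hpick hf0 hfL hη hε hεR hγ hγ1
    refine ⟨fun x hx => ?_, ?_⟩
    · have hs := support_historyLaw_finite B f T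
      refine ⟨PMF.integrable_of_support_finite hs _, ?_⟩
      rw [PMF.integral_eq_expect hs]
      refine (hB.expect_regretAgainst_le hx T).trans ?_
      change α ^ 2 * β ^ 2 * d / (2 * η) + T * (η * d ^ 2 * L ^ 2 * R ^ 2 / (2 * γ) +
        ε * L + γ * L * R) ≤ _
      -- The analysis yields `γ L R T`; the stated term `2 γ α L R T` is weaker.
      have h1 : 1 * (γ * L * R * T) ≤ (2 * α) * (γ * L * R * T) := by
        gcongr
        linarith
      have h2 : η * d ^ 2 * L ^ 2 * R ^ 2 / (2 * γ) = η * L ^ 2 * R ^ 2 * d ^ 2 / (2 * γ) := by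
        ring
      rw [h2]
      linarith
    · refine (hB.lintegral_totalCalls_le hβ hT).trans (le_of_eq ?_)
      change ENNReal.ofReal ((1 + γ * T) * callsBound d R α ε (α ^ 2 * β ^ 2 * d +
        η ^ 2 * L ^ 2 * R ^ 2 * d ^ 2 / γ * T + 6 * η * α * L * R * T)) = _
      have h3 : (d : ℝ) * (α ^ 2 * β ^ 2 * d + η ^ 2 * L ^ 2 * R ^ 2 * d ^ 2 / γ * T +
          6 * η * α * L * R * T) = α ^ 2 * β ^ 2 * d ^ 2 +
            η ^ 2 * L ^ 2 * R ^ 2 * d ^ 3 / γ * T + 6 * η * α * L * R * d * T := by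
        ring
      rw [callsBound, h3]
  refine ⟨general, fun hβT => ?_⟩
  intro η ε γ B
  have hd1 : (1 : ℝ) ≤ d := by exact_mod_cast Nat.pos_of_neZero d
  have hd0 : (0 : ℝ) < d := by linarith
  have hβ1 := hq.one_le
  -- From `β ≥ 1` and `d ≥ 1` one gets `T > 1`, and `T` is an integer; this keeps `log T` away from
  -- zero.
  have hT2 : (2 : ℝ) ≤ T := by
    have h1 : (1 : ℝ) < T :=
      (one_le_mul_of_one_le_of_one_le (one_le_pow₀ hβ1) (one_le_pow₀ hd1)).trans_lt hβT
    have h2 : 1 < T := by exact_mod_cast h1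
    exact_mod_cast h2
  have hη : 0 < η := by positivity
  have hε : 0 < ε := by positivity
  have hγ : 0 < γ := by positivity
  have hεR : ε ≤ α * R := div_le_self (by positivity) (by linarith)
  have hγ1 : γ < 1 := by
    refine (div_lt_one (by positivity)).2 (explorProb_lt_one_of_lt hβ hT0 hβT)
  obtain ⟨h1, h2⟩ := general η ε γ hη hε hεR hγ hγ1
  refine ⟨fun x hx => ⟨(h1 x hx).1, (h1 x hx).2.trans (le_of_eq ?_)⟩, h2.trans ?_⟩
  · exact regret_bound_eq hα0 hβ hL hR hT0 rfl rfl rfl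
  · exact ENNReal.ofReal_le_ofReal
      (calls_bound_le hd1 hα0 hβ1 hL hR hT2 hβT rfl rfl rfl)
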